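/- For each sample $m=1,2,\dots$ consider the linear regression with group-level treatment $$y_{i,j}=d_j\beta+w_{i,j}^\top\gamma+\varepsilon_{i,j},\qquad j=1,\dots,n_g,\quad i=1,\dots,n_j,\qquad n=\sum_{j\le n_g}n_j,$$ where the regressor of interest $d_j$ is scalar and constant within group $j$, $w_{i,j}$ is a vector of controls of fixed dimension $d_w\ge 1$, and $\varepsilon_{i,j}$ is an error with $\mathbb E[\varepsilon_{i,j}]=0$. The probability space, $n_g$, the $n_j$, the parameters and the laws of all variables may depend on the sample (the index $m$ is suppressed); $K$ denotes a positive constant, independent of the sample, that may differ between occurrences, and limits, $o_p$, $\to_p$ and $\to_d$ are as $m\to\infty$. Let $\hat\theta=(\hat\beta,\hat\gamma^\top)^\top=(\mathbf X^\top\mathbf X)^{-1}\mathbf X^\top\mathbf Y$ be the OLS estimator, where $\mathbf X$ has the rows $(d_j,w_{i,j}^\top)$ and $\mathbf Y$ the entries $y_{i,j}$. Put $$\kappa_n=\Big(\sum_{j\le n_g}n_j^2\Big)^{1/2},\qquad S_\varepsilon^2=n^{-1}\sum_{j\le n_g}\mathbb E\Big[\Big(\sum_{i\le n_j}\varepsilon_{i,j}\Big)^2\Big]<\infty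 .$$ Assume the following. (A) Controls: (i) $\lambda_{\min}\big(n^{-1}\sum_{j}\sum_{i}w_{i,j}w_{i,j}^\top\big)\ge K^{-1}+o_p(1)$; (ii) $\max_{j}\max_{i}\mathbb E\|w_{i,j}\|^2\le K$; (iii) the first component of the vectors $w_{i,j}$ is a non-zero constant. (B) Treatment: (i) the $d_j$, $1\le j\le n_g$, are i.i.d. with mean $\mu_d$ and variance $\sigma_d^2$, $\sigma_d\ge 0$; (ii) $(d_j)_{j}$ is independent of $(w_{i,j})_{i,j}$; (iii) $\max_j\mathbb E|d_j|^4\le K$; (iv) $\sigma_d^2\ge K^{-1}$; (v) $(d_j)_j$ is independent of $(\varepsilon_{i,j})_{i,j}$. (C) Errors and group sizes: (i) $n^{-1}\sum_j\sum_i w_{i,j}\varepsilon_{i,j}=o_p(S_\varepsilon n^{1/2}/\kappa_n)$; (ii) $S_\varepsilon^{-2}n^{-1}\sum_j\big(\sum_i\varepsilon_{i,j}\big)^2\to_p1$; (iii) there is a constant $\delta\in(0,2]$ with $n^{-1-\delta/2}\sum_j\big|\sum_i\varepsilon_{i,j}\big|^{2+\delta}=o_p(S_\varepsilon^{2+\delta})$;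 (iv) $\kappa_n/n\to0$. No restriction is placed on the dependence of the errors and controls across groups beyond these conditions. Then $\mathbf X^\top\mathbf X$ is invertible with probability tending to one, and $$\frac{\sqrt n(\hat\beta-\beta)}{S_\varepsilon/\sigma_d}=\frac{n^{-1/2}\sum_{j\le n_g}(d_j-\mu_d)\sum_{i\le n_j}\varepsilon_{i,j}}{\sigma_dS_\varepsilon}+o_p(1)\ \to_d\ N(0,1).$$ Moreover $S_\varepsilon^2=n^{-1}\sum_{j\le n_g}\operatorname{Var}\big(\sum_{i\le n_j}\varepsilon_{i,j}\big)$, so the asymptotic variance $S_\varepsilon^2/\sigma_d^2$ involves only the dependence of the errors within the groups at which treatment is assigned. -/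

import Mathlib

open MeasureTheory ProbabilityTheory Filter Topology

/-- `X m = o_p(r m)` as `m → ∞`, where `X m` lives on its own probability space `(Ω m, P m)`:
for every `δ > 0`, `P m (‖X m‖ > δ r m) → 0`. -/
def IsLittleOp {Ω : ℕ → Type*} [∀ m, MeasurableSpace (Ω m)] {E : Type*} [Norm E]
    (P : ∀ m, Measure (Ω m)) (X : ∀ m, Ω m → E) (r : ℕ → ℝ) : Prop :=
  ∀ δ : ℝ, 0 < δ → Tendsto (fun m => P m {ω | δ * r m < ‖X m ω‖}) atTop (𝓝 0)

/-- The random variables and parameters of a linear regression in which the regressor of interest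
is assigned at the level of groups.  There are `k + 1` controls.  Unit `i` of group `j` has
controls `w j i` and error `ε j i`; the regressor of interest `d j` is common to group `j`. -/
structure GroupSample (Ω : Type*) [MeasurableSpace Ω] (k : ℕ) where
  /-- number of groups -/
  groups : ℕ
  /-- group sizes -/
  size : Fin groups → ℕ
  /-- regressor of interest -/
  d : Fin groups → Ω → ℝ
  /-- controls -/
  w : (j : Fin groups) → Fin (size j) → Ω → EuclideanSpace ℝ (Fin (k + 1))
  /-- regression errors -/
  ε : (j : Fin groups) → Fin (size j) → Ω → ℝ
  /-- coefficient of interest -/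
  β : ℝ
  /-- coefficients of the controls -/
  γ : EuclideanSpace ℝ (Fin (k + 1))
  measurable_d : ∀ j, Measurable (d j)
  measurable_w : ∀ j i, Measurable (w j i)
  measurable_ε : ∀ j i, Measurable (ε j i)

namespace GroupSample

variable {Ω : Type*} [MeasurableSpace Ω] {k : ℕ} (M : GroupSample Ω k)

/-- Units: pairs of a group and a member of that group. -/
abbrev Obs : Type := (j : Fin M.groups) × Fin (M.size j)

/-- Total number of observations. -/
def n : ℕ := ∑ j, M.size j

/-- `κ = (∑ⱼ nⱼ²)^{1/2}`. -/
noncomputable def kappa : ℝ := √(∑ j, (M.size j : ℝ) ^ 2)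

/-- The outcome `y = d β + wᵀ γ + ε`. -/
noncomputable def y (o : M.Obs) (ω : Ω) : ℝ :=
  M.d o.1 ω * M.β + ∑ l, M.w o.1 o.2 ω l * M.γ l + M.ε o.1 o.2 ω

/-- The matrix of controls, with rows `wᵀ`. -/
def W (ω : Ω) : Matrix M.Obs (Fin (k + 1)) ℝ :=
  Matrix.of fun o l => M.w o.1 o.2 ω l

/-- The full design matrix, with rows `xᵀ = (d, wᵀ)`. -/
def X (ω : Ω) : Matrix M.Obs (Fin (k + 2)) ℝ :=
  Matrix.of fun o => Fin.cons (M.d o.1 ω) (fun l => M.w o.1 o.2 ω l)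

/-- The OLS estimator `(XᵀX)⁻¹ (XᵀY)` of `(β, γ)`. -/
noncomputable def olsTheta (ω : Ω) : Fin (k + 2) → ℝ :=
  ((M.X ω).transpose * M.X ω)⁻¹.mulVec ((M.X ω).transpose.mulVec fun o => M.y o ω)

/-- The OLS estimator of `β`: the first coordinate of the OLS estimator. -/
noncomputable def betaHat (ω : Ω) : ℝ := M.olsTheta ω 0

/-- The sum of the errors of group `j`. -/
def errSum (j : Fin M.groups) (ω : Ω) : ℝ := ∑ i, M.ε j i ω

/-- `S_ε² = n⁻¹ ∑ⱼ E[(∑ᵢ εᵢⱼ)²]`. -/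
noncomputable def Ssq (P : Measure Ω) : ℝ :=
  (M.n : ℝ)⁻¹ * ∑ j, ∫ ω, M.errSum j ω ^ 2 ∂P

/-- `S_ε`. -/
noncomputable def S (P : Measure Ω) : ℝ := √(M.Ssq P)

/-- `n⁻¹ ∑ w wᵀ`, the sample second moment matrix of the controls. -/
noncomputable def gram (ω : Ω) : Matrix (Fin (k + 1)) (Fin (k + 1)) ℝ :=
  (M.n : ℝ)⁻¹ • ((M.W ω).transpose * M.W ω)

theorem gram_isHermitian (ω : Ω) : (M.gram ω).IsHermitian := by
  unfold gram Matrix.IsHermitian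
  rw [Matrix.conjTranspose_eq_transpose_of_trivial, Matrix.transpose_smul, Matrix.transpose_mul,
    Matrix.transpose_transpose]

/-- The smallest eigenvalue of `n⁻¹ ∑ w wᵀ`. -/
noncomputable def lambdaMin (ω : Ω) : ℝ := ⨅ l, (M.gram_isHermitian ω).eigenvalues l

/-- `n^{-1/2} ∑ⱼ (dⱼ - μ_d) ∑ᵢ εᵢⱼ / (σ_d S_ε)`, the leading term of the estimation error. -/
noncomputable def score (P : Measure Ω) (μd σd : ℝ) (ω : Ω) : ℝ :=
  ((√(M.n : ℝ))⁻¹ * ∑ j, (M.d j ω - μd) * M.errSum j ω) / (σd * M.S P)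

/-- `√n (β̂ - β) / (S_ε / σ_d)`. -/
noncomputable def stdError (P : Measure Ω) (σd : ℝ) (ω : Ω) : ℝ :=
  (√(M.n : ℝ) * (M.betaHat ω - M.β)) / (M.S P / σd)

end GroupSample

section Assumptions

variable {k : ℕ} {Ω : ℕ → Type*} [∀ m, MeasurableSpace (Ω m)]

/-- The errors have mean zero, and the group sums of the errors have a finite second moment. -/
structure ErrorMoments (P : ∀ m, Measure (Ω m)) (M : ∀ m, GroupSample (Ω m) k) : Prop where
  integrable : ∀ m j i, Integrable ((M m).ε j i) (P m)
  mean_zero : ∀ m j i, ∫ ω, (M m).ε j i ω ∂(P m) = 0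
  sq_integrable : ∀ m j, MemLp ((M m).errSum j) 2 (P m)

/-- Conditions on the controls. -/
structure ControlConditions (P : ∀ m, Measure (Ω m)) (M : ∀ m, GroupSample (Ω m) k) : Prop where
  /-- `λ_min(n⁻¹ ∑ w wᵀ) ≥ K⁻¹ + o_p(1)` -/
  eigenvalue : ∃ K : ℝ, 0 < K ∧ ∃ r : ∀ m, Ω m → ℝ, IsLittleOp P r (fun _ => 1) ∧
    ∀ m ω, K⁻¹ + r m ω ≤ (M m).lambdaMin ω
  /-- `max E‖w‖² ≤ K` -/
  moment : ∃ K : ℝ, 0 < K ∧ ∀ m j i, MemLp ((M m).w j i) 2 (P m) ∧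
    ∫ ω, ‖(M m).w j i ω‖ ^ 2 ∂(P m) ≤ K
  /-- the first control is a non-zero constant -/
  intercept : ∀ m, ∃ c : ℝ, c ≠ 0 ∧ ∀ j i ω, (M m).w j i ω 0 = c

/-- Conditions on the regressor of interest, with mean `μd m` and standard deviation `σd m`. -/
structure TreatmentConditions (P : ∀ m, Measure (Ω m)) (M : ∀ m, GroupSample (Ω m) k)
    (μd σd : ℕ → ℝ) : Prop where
  indep : ∀ m, iIndepFun (M m).d (P m)
  identDistrib : ∀ m j j', IdentDistrib ((M m).d j) ((M m).d j') (P m) (P m)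
  mean : ∀ m j, ∫ ω, (M m).d j ω ∂(P m) = μd m
  variance : ∀ m j, Var[(M m).d j; P m] = σd m ^ 2
  indep_controls : ∀ m, IndepFun (fun ω j => (M m).d j ω)
    (fun ω (o : (M m).Obs) => (M m).w o.1 o.2 ω) (P m)
  /-- `max E|d|⁴ ≤ K` -/
  moment : ∃ K : ℝ, 0 < K ∧ ∀ m j, MemLp ((M m).d j) 4 (P m) ∧
    ∫ ω, |(M m).d j ω| ^ 4 ∂(P m) ≤ K
  sd_nonneg : ∀ m, 0 ≤ σd m
  variance_lower : ∃ K : ℝ, 0 < K ∧ ∀ m, K⁻¹ ≤ σd m ^ 2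
  indep_errors : ∀ m, IndepFun (fun ω j => (M m).d j ω)
    (fun ω (o : (M m).Obs) => (M m).ε o.1 o.2 ω) (P m)

/-- Conditions on the errors and on the group sizes. -/
structure ErrorConditions (P : ∀ m, Measure (Ω m)) (M : ∀ m, GroupSample (Ω m) k) : Prop where
  /-- `n⁻¹ ∑ⱼ ∑ᵢ w ε = o_p(S_ε n^{1/2} / κ)` -/
  orthogonality : IsLittleOp P
    (fun m ω => ((M m).n : ℝ)⁻¹ • ∑ j, ∑ i, (M m).ε j i ω • (M m).w j i ω)
    (fun m => (M m).S (P m) * √((M m).n : ℝ) / (M m).kappa)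
  /-- `S_ε⁻² n⁻¹ ∑ⱼ (∑ᵢ ε)² →_p 1` -/
  lln : IsLittleOp P
    (fun m ω => ((M m).Ssq (P m))⁻¹ * ((M m).n : ℝ)⁻¹ * ∑ j, (M m).errSum j ω ^ 2 - 1)
    (fun _ => 1)
  /-- `n^{-1-δ/2} ∑ⱼ |∑ᵢ ε|^{2+δ} = o_p(S_ε^{2+δ})` for some `δ ∈ (0, 2]` -/
  lyapunov : ∃ δ : ℝ, 0 < δ ∧ δ ≤ 2 ∧ IsLittleOp P
    (fun m ω => ((M m).n : ℝ) ^ (-1 - δ / 2) * ∑ j, |(M m).errSum j ω| ^ (2 + δ))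
    (fun m => (M m).S (P m) ^ (2 + δ))
  /-- `κ / n → 0`; together with `lln` this forces `n → ∞` -/
  sizes : Tendsto (fun m => (M m).kappa / ((M m).n : ℝ)) atTop (𝓝 0)

end Assumptions

/-! All the randomness that matters comes from the assignment of treatment. Let `D` be the centred
treatment, `u = WᵀD`, `v = Wᵀe`, and `r` the residual of `D` on the controls. Since a constant is
among the controls, Frisch–Waugh–Lovell gives `(r ⬝ r)(β̂ - β) = r ⬝ e`, where `r ⬝ r = D ⬝ D -
uᵀ(WᵀW)⁻¹u` and `r ⬝ e = D ⬝ e - uᵀ(WᵀW)⁻¹v`.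

Independent centred treatments make sums over groups uncorrelated whatever the dependence of the
other factor (`integral_sq_sum_mul_of_indepFun`). Hence `D ⬝ D = nσ²(1 + o_p(1))` and `|u| =
O_p(κ)`. As `WᵀW` is at least of order `n`, the correction to `D ⬝ D` is `O_p(κ²/n) = o_p(n)`. The
correction to `D ⬝ e` is at most `|u||v|/(cn)`, and the rate `S n^{1/2}/κ` assumed for `v/n` is
exactly what makes it `o_p(√n S)`. Bounding by norms separates `u` from `v`, so treatment need only
be independent of controls and of errors separately. `abs_stdError_sub_score_le` combines these
bounds pointwise.

The leading term is a sum of i.i.d. standardised treatments with weights `errSum / (√n S)`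
independent of them. Given the weights, its characteristic function is a product, close to the
Gaussian one when the squared weights sum to nearly 1 and the largest weight is small
(`tendsto_integral_exp_sum_mul`). No central limit theorem for the errors is needed. -/

/-! ### Calculus of `o_p(1)` and `O_p(1)` on varying probability spaces. -/

section StochasticOrder

variable {Ω : ℕ → Type*} [∀ m, MeasurableSpace (Ω m)] {P : ∀ m, Measure (Ω m)}

/-- `X m = O_p(1)` as `m → ∞`. -/
def IsBigOp (P : ∀ m, Measure (Ω m)) (X : ∀ m, Ω m → ℝ) : Prop :=
  ∀ η : ENNReal, 0 < η → ∃ C : ℝ, 0 < C ∧ ∀ᶠ m in atTop, P m {ω | C < |X m ω|} ≤ η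

/-- Domination off exceptional sets of vanishing probability suffices, so pointwise inequalities
that hold only on good events can be used. -/
theorem IsLittleOp.of_abs_le {X Y : ∀ m, Ω m → ℝ} (hY : IsLittleOp P Y fun _ => 1)
    (B : ∀ m, Set (Ω m)) (hB : Tendsto (fun m => P m (B m)) atTop (𝓝 0))
    (h : ∀ᶠ m in atTop, ∀ ω, ω ∉ B m → |X m ω| ≤ |Y m ω|) : IsLittleOp P X fun _ => 1 := by
  intro δ hδ
  have h1 := (hY δ hδ).add hB
  rw [add_zero] at h1
  refine tendsto_of_tendsto_of_tendsto_of_le_of_le' tendsto_const_nhds h1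
    (Eventually.of_forall fun _ => zero_le) ?_
  filter_upwards [h] with m hm
  refine (measure_mono ?_).trans (measure_union_le _ _)
  intro ω hω
  by_cases hb : ω ∈ B m
  · exact Or.inr hb
  · exact Or.inl (lt_of_lt_of_le hω (hm ω hb))

theorem IsLittleOp.add {X Y : ∀ m, Ω m → ℝ} (hX : IsLittleOp P X fun _ => 1)
    (hY : IsLittleOp P Y fun _ => 1) : IsLittleOp P (fun m ω => X m ω + Y m ω) fun _ => 1 := by
  intro δ hδ
  have h1 := (hX (δ / 2) (by positivity)).add (hY (δ / 2) (by positivity))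
  rw [add_zero] at h1
  refine tendsto_of_tendsto_of_tendsto_of_le_of_le tendsto_const_nhds h1
    (fun _ => zero_le) fun m => ?_
  refine (measure_mono ?_).trans (measure_union_le _ _)
  intro ω hω
  by_contra hc
  simp only [Set.mem_union, Set.mem_ofPred_eq, not_or, not_lt, Real.norm_eq_abs] at hω hc
  have := abs_add_le (X m ω) (Y m ω)
  linarith [hc.1, hc.2]

theorem IsBigOp.mul_littleOp {X Y : ∀ m, Ω m → ℝ} (hX : IsBigOp P X)
    (hY : IsLittleOp P Y fun _ => 1) : IsLittleOp P (fun m ω => X m ω * Y m ω) fun _ => 1 := by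
  intro δ hδ
  rw [ENNReal.tendsto_nhds_zero]
  intro η hη
  obtain ⟨C, hC, h1⟩ := hX (η / 2) (ENNReal.half_pos hη.ne')
  have h2 := ENNReal.tendsto_nhds_zero.1 (hY (δ / C) (by positivity)) (η / 2)
    (ENNReal.half_pos hη.ne')
  filter_upwards [h1, h2] with m hm1 hm2
  rw [← ENNReal.add_halves η]
  refine (measure_mono ?_).trans ((measure_union_le _ _).trans (add_le_add hm1 hm2))
  intro ω hω
  by_contra hc
  simp only [Set.mem_union, Set.mem_ofPred_eq, not_or, not_lt, Real.norm_eq_abs, mul_one,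
    abs_mul] at hω hc
  have := mul_le_mul hc.1 hc.2 (abs_nonneg _) hC.le
  rw [mul_div_cancel₀ _ hC.ne'] at this
  linarith

theorem IsBigOp.of_abs_le {X Y : ∀ m, Ω m → ℝ} (hY : IsBigOp P Y)
    (h : ∀ᶠ m in atTop, ∀ ω, |X m ω| ≤ |Y m ω|) : IsBigOp P X := by
  intro η hη
  obtain ⟨C, hC, h1⟩ := hY η hη
  refine ⟨C, hC, ?_⟩
  filter_upwards [h1, h] with m hm1 hm2
  exact (measure_mono fun ω (hω : C < _) => hω.trans_le (hm2 ω)).trans hm1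

theorem isBigOp_const {c : ℕ → ℝ} {C : ℝ} (h : ∀ m, |c m| ≤ C) :
    IsBigOp P fun m _ => c m := by
  intro η _
  refine ⟨|C| + 1, by positivity, Eventually.of_forall fun m => ?_⟩
  have : {ω : Ω m | |C| + 1 < |c m|} = ∅ := by
    ext ω
    simp only [Set.mem_ofPred_eq, Set.mem_empty_iff_false, iff_false, not_lt]
    linarith [h m, le_abs_self C]
  rw [this, measure_empty]
  exact zero_le

theorem IsLittleOp.isBigOp {X : ∀ m, Ω m → ℝ} (hX : IsLittleOp P X fun _ => 1) :
    IsBigOp P X := by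
  intro η hη
  refine ⟨1, one_pos, ?_⟩
  filter_upwards [ENNReal.tendsto_nhds_zero.1 (hX 1 one_pos) η hη] with m hm
  simpa using hm

/-- Chebyshev's inequality for a second moment. -/
theorem measure_lt_abs_le_integral_sq {Ω : Type*} [MeasurableSpace Ω] {P : Measure Ω}
    [IsFiniteMeasure P] {X : Ω → ℝ} (hX : Integrable (fun ω => X ω ^ 2) P) {c : ℝ} (hc : 0 < c) :
    P {ω | c < |X ω|} ≤ ENNReal.ofReal ((∫ ω, X ω ^ 2 ∂P) / c ^ 2) := by
  have h1 := mul_meas_ge_le_integral_of_nonneg (Eventually.of_forall fun ω => sq_nonneg (X ω)) hX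
    (c ^ 2)
  have h2 : P.real {ω | c < |X ω|} ≤ P.real {ω | c ^ 2 ≤ X ω ^ 2} := by
    refine measureReal_mono fun ω (hω : c < _) => ?_
    rw [Set.mem_ofPred_eq, ← sq_abs (X ω)]
    exact pow_le_pow_left₀ hc.le hω.le 2
  rw [ENNReal.le_ofReal_iff_toReal_le (measure_ne_top _ _)
    (div_nonneg (integral_nonneg fun _ => sq_nonneg _) (sq_nonneg _))]
  rw [le_div_iff₀ (by positivity)]
  have h3 : 0 < c ^ 2 := by positivity
  change P.real _ * _ ≤ _
  nlinarith

variable [∀ m, IsFiniteMeasure (P m)]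

theorem isLittleOp_of_integral_sq {X : ∀ m, Ω m → ℝ}
    (hX : ∀ m, Integrable (fun ω => X m ω ^ 2) (P m))
    (h : Tendsto (fun m => ∫ ω, X m ω ^ 2 ∂(P m)) atTop (𝓝 0)) :
    IsLittleOp P X fun _ => 1 := by
  intro δ hδ
  have h1 := ENNReal.tendsto_ofReal (h.div_const (δ ^ 2))
  rw [zero_div, ENNReal.ofReal_zero] at h1
  refine tendsto_of_tendsto_of_tendsto_of_le_of_le tendsto_const_nhds h1
    (fun _ => zero_le) fun m => ?_
  simpa using measure_lt_abs_le_integral_sq (hX m) hδ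

theorem isBigOp_of_integral_sq {X : ∀ m, Ω m → ℝ} {C : ℝ}
    (hX : ∀ m, Integrable (fun ω => X m ω ^ 2) (P m))
    (h : ∀ᶠ m in atTop, ∫ ω, X m ω ^ 2 ∂(P m) ≤ C) : IsBigOp P X := by
  intro η hη
  by_cases hη' : η = ⊤
  · exact ⟨1, one_pos, by simp [hη']⟩
  have hr : 0 < η.toReal := ENNReal.toReal_pos hη.ne' hη'
  -- The threshold `c` solves `(|C| + 1) / c² = η`, so that Chebyshev's bound is at most `η`.
  have hc : 0 < √((|C| + 1) / η.toReal) := by positivity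
  refine ⟨_, hc, ?_⟩
  filter_upwards [h] with m hm
  refine (measure_lt_abs_le_integral_sq (hX m) hc).trans ?_
  rw [Real.sq_sqrt (by positivity)]
  refine ENNReal.ofReal_le_of_le_toReal ?_
  rw [div_le_iff₀ (by positivity), mul_div_cancel₀ _ hr.ne']
  linarith [le_abs_self C]

end StochasticOrder

/-! ### Second moments of sums with independent centred factors. -/

section SecondMoment

/-- If `Z` has independent centred entries and is independent of `V`, then the summands of
`∑ Zⱼ Vⱼ` are uncorrelated. -/
theorem integral_sq_sum_mul_of_indepFun {Ω ι : Type*} [MeasurableSpace Ω] {P : Measure Ω}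
    [IsProbabilityMeasure P] [Fintype ι] {Z V : ι → Ω → ℝ}
    (hZm : ∀ j, Measurable (Z j)) (hVm : ∀ j, Measurable (V j))
    (hZ : ∀ j, MemLp (Z j) 2 P) (hV : ∀ j, MemLp (V j) 2 P)
    (hZi : iIndepFun Z P) (hZ0 : ∀ j, ∫ ω, Z j ω ∂P = 0)
    (hZV : IndepFun (fun ω j => Z j ω) (fun ω j => V j ω) P) :
    Integrable (fun ω => (∑ j, Z j ω * V j ω) ^ 2) P ∧
    ∫ ω, (∑ j, Z j ω * V j ω) ^ 2 ∂P
      = ∑ j, (∫ ω, Z j ω ^ 2 ∂P) * ∫ ω, V j ω ^ 2 ∂P := by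
  have hexp : ∀ ω, (∑ j, Z j ω * V j ω) ^ 2
      = ∑ i, ∑ j, (Z i ω * Z j ω) * (V i ω * V j ω) := fun ω => by
    rw [sq, Finset.sum_mul_sum]
    exact Finset.sum_congr rfl fun i _ => Finset.sum_congr rfl fun j _ => by ring
  have hind : ∀ i j, IndepFun (fun ω => Z i ω * Z j ω) (fun ω => V i ω * V j ω) P := fun i j =>
    hZV.comp (φ := fun z : ι → ℝ => z i * z j) (ψ := fun v : ι → ℝ => v i * v j)
      (by fun_prop) (by fun_prop)
  have hint : ∀ i j, Integrable (fun ω => (Z i ω * Z j ω) * (V i ω * V j ω)) P := fun i j =>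
    (hind i j).integrable_mul ((hZ i).integrable_mul (hZ j)) ((hV i).integrable_mul (hV j))
  have hval : ∀ i j, ∫ ω, (Z i ω * Z j ω) * (V i ω * V j ω) ∂P
      = (∫ ω, Z i ω * Z j ω ∂P) * ∫ ω, V i ω * V j ω ∂P := fun i j =>
    (hind i j).integral_fun_mul_eq_mul_integral (by fun_prop) (by fun_prop)
  simp only [hexp]
  refine ⟨integrable_finsetSum _ fun i _ => integrable_finsetSum _ fun j _ => hint i j, ?_⟩
  rw [integral_finsetSum _ fun i _ => integrable_finsetSum _ fun j _ => hint i j]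
  refine Finset.sum_congr rfl fun i _ => ?_
  -- Only the diagonal survives: off it `E[Zᵢ Zⱼ] = 0`, however dependent the `Vⱼ` are.
  rw [integral_finsetSum _ fun j _ => hint i j, Finset.sum_eq_single i]
  · rw [hval]
    simp only [sq]
  · intro j _ hj
    rw [hval, (hZi.indepFun hj.symm).integral_fun_mul_eq_mul_integral (by fun_prop) (by fun_prop),
      hZ0 i]
    ring
  · simp

end SecondMoment

/-! ### Central limit theorem with random weights, by characteristic functions. -/

section WeightedCLT

/-- Taylor's bound covers `|x| ≤ 2`; beyond that the trivial bound `2 + |x| + x²/2` is already below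
`|x|³`. The cubic remainder lets third moments control the error. -/
theorem norm_exp_mul_I_sub_quadratic_le (x : ℝ) :
    ‖Complex.exp (x * Complex.I) - (1 + x * Complex.I - x ^ 2 / 2)‖ ≤ |x| ^ 3 := by
  by_cases hx : |x| ≤ 2
  · have h := Complex.exp_bound' (x := x * Complex.I) (n := 3) (by
      simp only [norm_mul, Complex.norm_real, Complex.norm_I, mul_one, Real.norm_eq_abs]
      norm_num
      linarith)
    have e : ∑ m ∈ Finset.range 3, ((x : ℂ) * Complex.I) ^ m / (m.factorial : ℂ)
        = 1 + x * Complex.I - x ^ 2 / 2 := by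
      simp [Finset.sum_range_succ, mul_pow]
      ring
    rw [e] at h
    refine h.trans ?_
    simp only [norm_mul, Complex.norm_real, Complex.norm_I, mul_one, Real.norm_eq_abs]
    have : 0 ≤ |x| ^ 3 := by positivity
    norm_num [Nat.factorial]
    linarith
  · push Not at hx
    have h1 : ‖Complex.exp (x * Complex.I)‖ = 1 := Complex.norm_exp_ofReal_mul_I x
    have h2 : ‖(1 + x * Complex.I - x ^ 2 / 2 : ℂ)‖ ≤ 1 + |x| + |x| ^ 2 / 2 := by
      refine (norm_sub_le _ _).trans (add_le_add ((norm_add_le _ _).trans ?_) ?_)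
      · simp
      · simp
    refine (norm_sub_le _ _).trans ?_
    rw [h1]
    nlinarith [sq_nonneg (|x| - 2), mul_pos (sub_pos.2 hx) (sub_pos.2 hx)]

theorem abs_exp_neg_sub_linear_le {y : ℝ} (hy : 0 ≤ y) :
    |Real.exp (-y) - (1 - y)| ≤ y ^ 2 := by
  by_cases h : y ≤ 1
  · have := Real.abs_exp_sub_one_sub_id_le (x := -y) (by rwa [abs_neg, abs_of_nonneg hy])
    rw [neg_sq] at this
    convert this using 2
    ring
  · push Not at h
    have h1 := Real.add_one_le_exp (-y)
    have h2 : Real.exp (-y) ≤ 1 := Real.exp_le_one_iff.2 (by linarith)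
    rw [abs_of_nonneg (by linarith)]
    nlinarith

theorem abs_exp_neg_sub_exp_neg_le {x y : ℝ} (hx : 0 ≤ x) (hy : 0 ≤ y) :
    |Real.exp (-x) - Real.exp (-y)| ≤ |x - y| := by
  wlog h : x ≤ y generalizing x y
  · rw [abs_sub_comm, abs_sub_comm x]
    exact this hy hx (le_of_not_ge h)
  have h1 : Real.exp (-y) ≤ Real.exp (-x) := Real.exp_le_exp.2 (by linarith)
  rw [abs_of_nonneg (by linarith), abs_of_nonpos (by linarith)]
  have h2 : Real.exp (-x) ≤ 1 := Real.exp_le_one_iff.2 (by linarith)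
  have h3 : Real.exp (-y) = Real.exp (-x) * Real.exp (-(y - x)) := by
    rw [← Real.exp_add]
    ring_nf
  have h4 := Real.one_sub_le_exp_neg (y - x)
  have h5 := Real.exp_pos (-x)
  nlinarith

/-- Telescoping: exchange one factor at a time, all the others having norm at most 1. -/
theorem norm_prod_sub_prod_le_sum {ι : Type*} (s : Finset ι) (f g : ι → ℂ)
    (hf : ∀ i, ‖f i‖ ≤ 1) (hg : ∀ i, ‖g i‖ ≤ 1) :
    ‖∏ i ∈ s, f i - ∏ i ∈ s, g i‖ ≤ ∑ i ∈ s, ‖f i - g i‖ := by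
  classical
  induction s using Finset.induction_on with
  | empty => simp
  | insert a s ha ih =>
    rw [Finset.prod_insert ha, Finset.prod_insert ha, Finset.sum_insert ha]
    have e : f a * ∏ i ∈ s, f i - g a * ∏ i ∈ s, g i
        = (f a - g a) * ∏ i ∈ s, f i + g a * (∏ i ∈ s, f i - ∏ i ∈ s, g i) := by ring
    rw [e]
    refine (norm_add_le _ _).trans (add_le_add ?_ ?_)
    · rw [norm_mul]
      refine mul_le_of_le_one_right (norm_nonneg _) ?_
      rw [norm_prod]
      exact Finset.prod_le_one (fun _ _ => norm_nonneg _) fun i _ => hf i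
    · rw [norm_mul]
      exact (mul_le_of_le_one_left (norm_nonneg _) (hg a)).trans ih

variable {Ω ι : Type*} [MeasurableSpace Ω] {P : Measure Ω} [IsProbabilityMeasure P]

/-- Second order expansion of a characteristic function, with an explicit remainder. -/
theorem norm_charFun_map_sub_le {Z : Ω → ℝ} (hZ : Measurable Z)
    (h3 : Integrable (fun ω => |Z ω| ^ 3) P) (h2 : Integrable (fun ω => Z ω ^ 2) P)
    (h1 : Integrable Z P)
    (m1 : ∫ ω, Z ω ∂P = 0) (m2 : ∫ ω, Z ω ^ 2 ∂P = 1) (s : ℝ) :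
    ‖charFun (P.map Z) s - (1 - s ^ 2 / 2 : ℝ)‖ ≤ |s| ^ 3 * ∫ ω, |Z ω| ^ 3 ∂P := by
  rw [charFun_apply_real, integral_map hZ.aemeasurable (by fun_prop)]
  have hq : Integrable (fun ω =>
      (1 + (s * Z ω : ℝ) * Complex.I - (s * Z ω : ℝ) ^ 2 / 2 : ℂ)) P := by
    have a1 := ((h1.const_mul s).ofReal (𝕜 := ℂ)).mul_const Complex.I
    have a2 := ((h2.const_mul (s ^ 2)).ofReal (𝕜 := ℂ)).div_const 2
    refine (((integrable_const 1).add a1).sub a2).congr (Eventually.of_forall fun ω => ?_)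
    simp [mul_pow]
  have hv : ∫ ω, (1 + (s * Z ω : ℝ) * Complex.I - (s * Z ω : ℝ) ^ 2 / 2 : ℂ) ∂P
      = (1 - s ^ 2 / 2 : ℝ) := by
    have a1 : Integrable (fun ω => ((s * Z ω : ℝ) : ℂ) * Complex.I) P :=
      ((h1.const_mul s).ofReal (𝕜 := ℂ)).mul_const Complex.I
    have a2 : Integrable (fun ω => ((s ^ 2 * Z ω ^ 2 : ℝ) : ℂ) / 2) P :=
      ((h2.const_mul (s ^ 2)).ofReal (𝕜 := ℂ)).div_const 2
    have : ∀ ω, (1 + (s * Z ω : ℝ) * Complex.I - (s * Z ω : ℝ) ^ 2 / 2 : ℂ)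
      = 1 + ((s * Z ω : ℝ) : ℂ) * Complex.I - ((s ^ 2 * Z ω ^ 2 : ℝ) : ℂ) / 2 := fun ω => by
        simp [mul_pow]
    simp only [this]
    have a0 : Integrable (fun ω => 1 + ((s * Z ω : ℝ) : ℂ) * Complex.I) P :=
      (integrable_const 1).add a1
    rw [integral_sub a0 a2, integral_add (integrable_const 1) a1,
      integral_mul_const, integral_div, integral_complex_ofReal,
      integral_complex_ofReal, integral_const_mul,
      integral_const_mul, m1, m2]
    simp
  have he : Integrable (fun ω => Complex.exp (s * Z ω * Complex.I)) P := by
    refine Integrable.of_bound (by fun_prop) 1 (Eventually.of_forall fun ω => ?_)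
    have := Complex.norm_exp_ofReal_mul_I (s * Z ω)
    push_cast at this
    exact this.le
  rw [← hv, ← integral_sub he hq]
  refine (norm_integral_le_integral_norm _).trans ?_
  rw [← integral_const_mul]
  refine integral_mono (he.sub hq).norm (h3.const_mul _) fun ω => ?_
  have := norm_exp_mul_I_sub_quadratic_le (s * Z ω)
  rw [abs_mul, mul_pow] at this
  push_cast at this ⊢
  exact this

/-- Comparison of a weighted product of characteristic functions with the Gaussian one. -/
theorem norm_prod_charFun_sub_le [Fintype ι] {Z : ι → Ω → ℝ} (hZ : ∀ j, Measurable (Z j))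
    (h3 : ∀ j, Integrable (fun ω => |Z j ω| ^ 3) P)
    (h2 : ∀ j, Integrable (fun ω => Z j ω ^ 2) P) (h1 : ∀ j, Integrable (Z j) P)
    (m1 : ∀ j, ∫ ω, Z j ω ∂P = 0) (m2 : ∀ j, ∫ ω, Z j ω ^ 2 ∂P = 1)
    {C : ℝ} (hC0 : 0 ≤ C) (hC : ∀ j, ∫ ω, |Z j ω| ^ 3 ∂P ≤ C) (a : ι → ℝ) (t : ℝ)
    {η : ℝ} (hη1 : η ≤ 1) (ha : ∀ j, |a j| ≤ η) (hs : |∑ j, a j ^ 2 - 1| ≤ η) :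
    ‖∏ j, charFun (P.map (Z j)) (t * a j) - (Real.exp (-(t ^ 2 / 2)) : ℂ)‖
      ≤ (2 * (|t| ^ 3 * C + t ^ 4) + t ^ 2) * η := by
  have hη0 : 0 ≤ η := (abs_nonneg _).trans hs
  have hprob : ∀ j, IsProbabilityMeasure (P.map (Z j)) := fun j =>
    Measure.isProbabilityMeasure_map (hZ j).aemeasurable
  -- The bound on the largest weight pays for one factor `η`; a factor `a j ^ 2` is kept, so that
  -- the errors sum to a multiple of `∑ a j ^ 2 ≤ 2`.
  have hterm : ∀ j, ‖charFun (P.map (Z j)) (t * a j)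
      - (Real.exp (-((t * a j) ^ 2 / 2)) : ℂ)‖ ≤ (|t| ^ 3 * C + t ^ 4) * η * a j ^ 2 := by
    intro j
    have b1 := norm_charFun_map_sub_le (hZ j) (h3 j) (h2 j) (h1 j) (m1 j) (m2 j) (t * a j)
    have b2 := abs_exp_neg_sub_linear_le (y := (t * a j) ^ 2 / 2) (by positivity)
    rw [← Real.norm_eq_abs, ← Complex.norm_real, Complex.ofReal_sub, norm_sub_rev] at b2
    have b3 := (norm_sub_le_norm_sub_add_norm_sub _ _ _).trans (add_le_add b1 b2)
    refine b3.trans ?_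
    have c1 : |t * a j| ^ 3 * ∫ ω, |Z j ω| ^ 3 ∂P ≤ |t| ^ 3 * C * η * a j ^ 2 := by
      calc |t * a j| ^ 3 * ∫ ω, |Z j ω| ^ 3 ∂P ≤ |t * a j| ^ 3 * C := by gcongr; exact hC j
        _ = |t| ^ 3 * C * |a j| * a j ^ 2 := by rw [abs_mul, ← sq_abs (a j)]; ring
        _ ≤ _ := by gcongr; exact ha j
    have c2 : ((t * a j) ^ 2 / 2) ^ 2 ≤ t ^ 4 * η * a j ^ 2 := by
      have : a j ^ 2 ≤ η := by
        rw [← sq_abs]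
        nlinarith [ha j, abs_nonneg (a j)]
      calc ((t * a j) ^ 2 / 2) ^ 2 = t ^ 4 * a j ^ 2 * a j ^ 2 / 4 := by ring
        _ ≤ t ^ 4 * a j ^ 2 * a j ^ 2 := by
          have : 0 ≤ t ^ 4 * a j ^ 2 * a j ^ 2 := by positivity
          linarith
        _ ≤ _ := by gcongr
    linarith
  have hsum : ‖∏ j, charFun (P.map (Z j)) (t * a j)
      - ∏ j, (Real.exp (-((t * a j) ^ 2 / 2)) : ℂ)‖ ≤ 2 * (|t| ^ 3 * C + t ^ 4) * η := by
    refine (norm_prod_sub_prod_le_sum _ _ _ (fun j => norm_charFun_le_one _) fun j => ?_).trans ?_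
    · rw [Complex.norm_real, Real.norm_eq_abs, abs_of_pos (Real.exp_pos _), Real.exp_le_one_iff]
      have : 0 ≤ (t * a j) ^ 2 / 2 := by positivity
      linarith
    · refine (Finset.sum_le_sum fun j _ => hterm j).trans ?_
      rw [← Finset.mul_sum]
      have h0 : 0 ≤ (|t| ^ 3 * C + t ^ 4) * η := by positivity
      have h2 : ∑ j, a j ^ 2 ≤ 2 := by linarith [le_abs_self (∑ j, a j ^ 2 - 1)]
      nlinarith
  have hprod : ∏ j, (Real.exp (-((t * a j) ^ 2 / 2)) : ℂ)
      = (Real.exp (-(t ^ 2 / 2 * ∑ j, a j ^ 2)) : ℂ) := by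
    rw [← Complex.ofReal_prod, ← Real.exp_sum]
    congr 2
    rw [Finset.mul_sum, ← Finset.sum_neg_distrib]
    exact Finset.sum_congr rfl fun j _ => by ring
  rw [hprod] at hsum
  -- The remaining error, from `∑ a j ^ 2` not being exactly 1, gives the term `t ^ 2 * η`.
  have hlast := abs_exp_neg_sub_exp_neg_le (x := t ^ 2 / 2 * ∑ j, a j ^ 2) (y := t ^ 2 / 2)
    (by positivity) (by positivity)
  rw [← Real.norm_eq_abs, ← Complex.norm_real, Complex.ofReal_sub] at hlast
  refine ((norm_sub_le_norm_sub_add_norm_sub _ _ _).trans (add_le_add hsum hlast)).trans ?_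
  have : |t ^ 2 / 2 * ∑ j, a j ^ 2 - t ^ 2 / 2| ≤ t ^ 2 * η := by
    rw [← mul_sub_one, abs_mul, abs_of_nonneg (by positivity)]
    have : 0 ≤ t ^ 2 := sq_nonneg t
    nlinarith [abs_nonneg (∑ j, a j ^ 2 - 1)]
  linarith

/-- Characteristic function of a randomly weighted sum, by conditioning on the weights. -/
theorem integral_exp_sum_mul_of_indepFun [Fintype ι] {Z A : ι → Ω → ℝ}
    (hZ : ∀ j, Measurable (Z j)) (hA : ∀ j, Measurable (A j)) (hZi : iIndepFun Z P)
    (hZA : IndepFun (fun ω j => Z j ω) (fun ω j => A j ω) P) (t : ℝ) :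
    ∫ ω, Complex.exp (t * (∑ j, Z j ω * A j ω : ℝ) * Complex.I) ∂P
      = ∫ ω, ∏ j, charFun (P.map (Z j)) (t * A j ω) ∂P := by
  have hZm : Measurable fun ω j => Z j ω := measurable_pi_lambda _ hZ
  have hAm : Measurable fun ω j => A j ω := measurable_pi_lambda _ hA
  have hprobA : IsProbabilityMeasure (P.map fun ω j => A j ω) :=
    Measure.isProbabilityMeasure_map hAm.aemeasurable
  have hprobZ : IsProbabilityMeasure (P.map fun ω j => Z j ω) :=
    Measure.isProbabilityMeasure_map hZm.aemeasurable
  let F : (ι → ℝ) × (ι → ℝ) → ℂ := fun p =>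
    Complex.exp (t * (∑ j, p.2 j * p.1 j : ℝ) * Complex.I)
  have hF : Measurable F := by fun_prop
  -- The weights form the first coordinate, so that Fubini integrates `Z` out with the weights
  -- frozen.
  have hjoint := (indepFun_iff_map_prod_eq_prod_map_map hAm.aemeasurable hZm.aemeasurable).1
    hZA.symm
  have e1 : ∫ ω, Complex.exp (t * (∑ j, Z j ω * A j ω : ℝ) * Complex.I) ∂P
      = ∫ p, F p ∂((P.map fun ω j => A j ω).prod (P.map fun ω j => Z j ω)) := by
    rw [← hjoint, integral_map (hAm.prodMk hZm).aemeasurable hF.aestronglyMeasurable]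
  have hFi : Integrable F ((P.map fun ω j => A j ω).prod (P.map fun ω j => Z j ω)) := by
    refine Integrable.of_bound hF.aestronglyMeasurable 1 (Eventually.of_forall fun p => ?_)
    have := Complex.norm_exp_ofReal_mul_I (t * ∑ j, p.2 j * p.1 j)
    push_cast at this
    simp only [F]
    push_cast
    exact this.le
  rw [e1, integral_prod _ hFi]
  have hcF : ∀ a : ι → ℝ, ∫ z, F (a, z) ∂(P.map fun ω j => Z j ω)
      = ∏ j, charFun (P.map (Z j)) (t * a j) := by
    intro a
    rw [integral_map hZm.aemeasurable (by fun_prop)]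
    have e2 : ∀ ω, F (a, fun j => Z j ω)
        = ∏ j, Complex.exp ((t * a j : ℝ) * Z j ω * Complex.I) := fun ω => by
      rw [← Complex.exp_sum]
      simp only [F]
      push_cast
      rw [Finset.mul_sum, Finset.sum_mul]
      congr 1
      exact Finset.sum_congr rfl fun j _ => by ring
    simp only [e2]
    rw [hZi.integral_fun_prod_comp
      (f := fun j (x : ℝ) => Complex.exp ((t * a j : ℝ) * x * Complex.I))
      (fun j => (hZ j).aemeasurable) fun j => by fun_prop]
    refine Finset.prod_congr rfl fun j _ => ?_
    rw [charFun_apply_real, integral_map (hZ j).aemeasurable (by fun_prop)]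
  simp only [hcF]
  rw [integral_map hAm.aemeasurable]
  refine Measurable.aestronglyMeasurable ?_
  refine Finset.measurable_prod _ fun j _ => ?_
  have := Measure.isProbabilityMeasure_map (μ := P) (hZ j).aemeasurable
  exact continuous_charFun.measurable.comp (by fun_prop)

/-- The integrand is at most `δ` off the exceptional event and at most 2 on it. This turns closeness
in probability of bounded variables into closeness of expectations. -/
theorem norm_integral_sub_integral_le {Φ Ψ : Ω → ℂ} (hΦ : Measurable Φ) (hΨ : Measurable Ψ)
    (h1 : ∀ ω, ‖Φ ω‖ ≤ 1) (h2 : ∀ ω, ‖Ψ ω‖ ≤ 1) {δ : ℝ} (hδ : 0 ≤ δ) :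
    ‖∫ ω, Φ ω ∂P - ∫ ω, Ψ ω ∂P‖ ≤ δ + 2 * P.real {ω | δ < ‖Φ ω - Ψ ω‖} := by
  have hi : Integrable Φ P :=
    Integrable.of_bound hΦ.aestronglyMeasurable 1 (Eventually.of_forall h1)
  have hj : Integrable Ψ P :=
    Integrable.of_bound hΨ.aestronglyMeasurable 1 (Eventually.of_forall h2)
  have hm : MeasurableSet {ω | δ < ‖Φ ω - Ψ ω‖} := measurableSet_lt (by fun_prop) (by fun_prop)
  rw [← integral_sub hi hj]
  refine (norm_integral_le_integral_norm _).trans ?_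
  have hi2 : Integrable (fun ω => δ + 2 * {ω | δ < ‖Φ ω - Ψ ω‖}.indicator (fun _ => (1 : ℝ)) ω) P :=
    (integrable_const δ).add (((integrable_const 1).indicator hm).const_mul 2)
  have := integral_mono (μ := P) (hi.sub hj).norm hi2 fun ω => ?_
  · rw [integral_add (integrable_const δ) (((integrable_const 1).indicator hm).const_mul 2),
      integral_const_mul, integral_indicator_const _ hm] at this
    simpa using this
  · by_cases h : δ < ‖Φ ω - Ψ ω‖
    · have h3 : ‖Φ ω - Ψ ω‖ ≤ 2 := (norm_sub_le _ _).trans (by linarith [h1 ω, h2 ω])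
      simp only [Set.indicator, Set.mem_ofPred_eq, h, if_true]
      change ‖Φ ω - Ψ ω‖ ≤ _
      linarith
    · simp only [Set.indicator, Set.mem_ofPred_eq, h, if_false]
      change ‖Φ ω - Ψ ω‖ ≤ _
      linarith

end WeightedCLT

/-- Central limit theorem for sums of independent standardised variables with random weights that
are independent of the summands, in terms of characteristic functions. -/
theorem tendsto_integral_exp_sum_mul {Ω : ℕ → Type*} [∀ m, MeasurableSpace (Ω m)]
    {P : ∀ m, Measure (Ω m)} [∀ m, IsProbabilityMeasure (P m)] {ι : ℕ → Type*}
    [∀ m, Fintype (ι m)] {Z A : ∀ m, ι m → Ω m → ℝ}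
    (hZ : ∀ m j, Measurable (Z m j)) (hA : ∀ m j, Measurable (A m j))
    (hZi : ∀ m, iIndepFun (Z m) (P m))
    (hZA : ∀ m, IndepFun (fun ω j => Z m j ω) (fun ω j => A m j ω) (P m))
    (h3 : ∀ m j, Integrable (fun ω => |Z m j ω| ^ 3) (P m))
    (h2 : ∀ m j, Integrable (fun ω => Z m j ω ^ 2) (P m)) (h1 : ∀ m j, Integrable (Z m j) (P m))
    (m1 : ∀ m j, ∫ ω, Z m j ω ∂(P m) = 0) (m2 : ∀ m j, ∫ ω, Z m j ω ^ 2 ∂(P m) = 1)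
    {C : ℝ} (hC0 : 0 ≤ C) (hC : ∀ m j, ∫ ω, |Z m j ω| ^ 3 ∂(P m) ≤ C)
    (hsum : IsLittleOp P (fun m ω => ∑ j, A m j ω ^ 2 - 1) fun _ => 1)
    (hmax : ∀ η : ℝ, 0 < η → Tendsto (fun m => P m {ω | ∃ j, η < |A m j ω|}) atTop (𝓝 0)) (t : ℝ) :
    Tendsto (fun m => ∫ ω, Complex.exp (t * (∑ j, Z m j ω * A m j ω : ℝ) * Complex.I) ∂(P m))
      atTop (𝓝 (Real.exp (-(t ^ 2 / 2)) : ℂ)) := by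
  simp only [fun m => integral_exp_sum_mul_of_indepFun (hZ m) (hA m) (hZi m) (hZA m) t]
  have hprob : ∀ m j, IsProbabilityMeasure ((P m).map (Z m j)) := fun m j =>
    Measure.isProbabilityMeasure_map (hZ m j).aemeasurable
  rw [Metric.tendsto_atTop']
  intro δ hδ
  set L : ℝ := 2 * (|t| ^ 3 * C + t ^ 4) + t ^ 2 with hL
  have hL0 : 0 ≤ L := by positivity
  -- The comparison with the Gaussian needs `η ≤ 1`, and its error `L * η` must be at most `δ / 2`;
  -- the `+ 1` avoids dividing by zero.
  set η : ℝ := min 1 (δ / 2 / (L + 1)) with hη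
  have hη0 : 0 < η := lt_min one_pos (by positivity)
  have hLη : L * η ≤ δ / 2 := by
    have : η * (L + 1) ≤ δ / 2 := (le_div_iff₀ (by positivity)).1 (min_le_right _ _)
    nlinarith
  have hlim := (hmax η hη0).add (hsum η hη0)
  rw [add_zero] at hlim
  -- The bad event counts twice, so the total error is at most `δ / 2 + 2 * (δ / 8) < δ`.
  have hev := ENNReal.tendsto_nhds_zero.1 hlim (ENNReal.ofReal (δ / 8)) (by positivity)
  obtain ⟨N, hN⟩ := eventually_atTop.1 hev
  refine ⟨N, fun m hm => ?_⟩
  rw [dist_eq_norm]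
  have hΦ : Measurable fun ω => ∏ j, charFun ((P m).map (Z m j)) (t * A m j ω) :=
    Finset.measurable_prod _ fun j _ => continuous_charFun.measurable.comp (by
      have := hA m j
      fun_prop)
  have hconst : (Real.exp (-(t ^ 2 / 2)) : ℂ) = ∫ _, (Real.exp (-(t ^ 2 / 2)) : ℂ) ∂(P m) := by simp
  rw [hconst]
  refine (norm_integral_sub_integral_le hΦ measurable_const (fun ω => ?_) (fun _ => ?_)
    (half_pos hδ).le).trans_lt ?_
  · rw [norm_prod]
    exact Finset.prod_le_one (fun _ _ => norm_nonneg _) fun j _ => norm_charFun_le_one _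
  · rw [Complex.norm_real, Real.norm_eq_abs, abs_of_pos (Real.exp_pos _), Real.exp_le_one_iff]
    have : 0 ≤ t ^ 2 / 2 := by positivity
    linarith
  · have hsub : P m {ω | δ / 2 < ‖∏ j, charFun ((P m).map (Z m j)) (t * A m j ω)
        - (Real.exp (-(t ^ 2 / 2)) : ℂ)‖} ≤ ENNReal.ofReal (δ / 8) := by
      refine le_trans ((measure_mono ?_).trans (measure_union_le _ _)) (hN m hm.le)
      intro ω hω
      by_contra hc
      simp only [Set.mem_union, Set.mem_ofPred_eq, not_or, not_lt, not_exists, mul_one,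
        Real.norm_eq_abs] at hω hc
      have := norm_prod_charFun_sub_le (hZ m) (h3 m) (h2 m) (h1 m) (m1 m) (m2 m) hC0 (hC m)
        (fun j => A m j ω) t (min_le_left _ _) hc.1 hc.2
      linarith
    have := ENNReal.toReal_le_of_le_ofReal (by positivity) hsub
    change (P m).real _ ≤ _ at this
    linarith

/-- Convergence in distribution to the standard normal law, for a sequence that differs by
`o_p(1)` from one whose characteristic functions converge. -/
theorem tendstoInDistribution_gaussianReal_of_sub {Ω : ℕ → Type*} [∀ m, MeasurableSpace (Ω m)]
    {P : ∀ m, Measure (Ω m)} [∀ m, IsProbabilityMeasure (P m)] {X Y : ∀ m, Ω m → ℝ}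
    (hX : ∀ m, Measurable (X m)) (hY : ∀ m, Measurable (Y m))
    (hXY : IsLittleOp P (fun m ω => X m ω - Y m ω) fun _ => 1)
    (h : ∀ t : ℝ, Tendsto (fun m => ∫ ω, Complex.exp (t * (Y m ω : ℝ) * Complex.I) ∂(P m))
      atTop (𝓝 (Real.exp (-(t ^ 2 / 2)) : ℂ))) :
    TendstoInDistribution X atTop (id : ℝ → ℝ) P (gaussianReal 0 1) := by
  refine ⟨fun m => (hX m).aemeasurable, aemeasurable_id, ?_⟩
  refine ProbabilityMeasure.tendsto_of_tendsto_charFun fun t => ?_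
  simp only [ProbabilityMeasure.coe_mk, Measure.map_id, charFun_gaussianReal]
  have hlim : Complex.exp (t * (0 : ℝ) * Complex.I - ((1 : NNReal) : ℝ) * t ^ 2 / 2)
      = (Real.exp (-(t ^ 2 / 2)) : ℂ) := by
    push_cast
    congr 1
    ring
  rw [hlim]
  have hd : Tendsto (fun m => ∫ ω, Complex.exp (t * (X m ω : ℝ) * Complex.I) ∂(P m)
      - ∫ ω, Complex.exp (t * (Y m ω : ℝ) * Complex.I) ∂(P m)) atTop (𝓝 0) := by
    rw [Metric.tendsto_atTop']
    intro δ hδ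
    have hev := ENNReal.tendsto_nhds_zero.1 (hXY (δ / 2 / (|t| + 1)) (by positivity))
      (ENNReal.ofReal (δ / 8)) (by positivity)
    obtain ⟨N, hN⟩ := eventually_atTop.1 hev
    refine ⟨N, fun m hm => ?_⟩
    rw [dist_eq_norm, sub_zero]
    have hnorm : ∀ x : ℝ, ‖Complex.exp (t * x * Complex.I)‖ = 1 := fun x => by
      have := Complex.norm_exp_ofReal_mul_I (t * x)
      push_cast at this
      exact this
    have := hX m
    have := hY m
    refine (norm_integral_sub_integral_le (by fun_prop) (by fun_prop) (fun ω => (hnorm _).le)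
      (fun ω => (hnorm _).le) (half_pos hδ).le).trans_lt ?_
    have hsub : P m {ω | δ / 2 < ‖Complex.exp (t * (X m ω : ℝ) * Complex.I)
        - Complex.exp (t * (Y m ω : ℝ) * Complex.I)‖} ≤ ENNReal.ofReal (δ / 8) := by
      refine le_trans (measure_mono fun ω hω => ?_) (hN m hm.le)
      simp only [Set.mem_ofPred_eq, mul_one, Real.norm_eq_abs] at hω ⊢
      -- Factoring out a number of modulus 1 bounds the difference by `|t| |X - Y|`.
      have e : Complex.exp (t * (X m ω : ℝ) * Complex.I) - Complex.exp (t * (Y m ω : ℝ) * Complex.I)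
          = (Complex.exp (Complex.I * (t * (X m ω - Y m ω) : ℝ)) - 1)
            * Complex.exp (t * (Y m ω : ℝ) * Complex.I) := by
        rw [sub_mul, one_mul, ← Complex.exp_add]
        congr 2
        push_cast
        ring
      rw [e, norm_mul, hnorm, mul_one] at hω
      have h2 := hω.trans_le Real.norm_exp_I_mul_ofReal_sub_one_le
      rw [Real.norm_eq_abs, abs_mul] at h2
      rw [div_lt_iff₀ (by positivity)]
      nlinarith [abs_nonneg (X m ω - Y m ω)]
    have := ENNReal.toReal_le_of_le_ofReal (by positivity) hsub
    change (P m).real _ ≤ _ at this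
    linarith
  have := hd.add (h t)
  rw [zero_add] at this
  refine this.congr fun m => ?_
  rw [sub_add_cancel, charFun_apply_real, integral_map (hX m).aemeasurable (by fun_prop)]

/-! ### Least squares algebra and Frisch–Waugh–Lovell. -/

section LeastSquares

open Matrix

/-- The quadratic form of a Hermitian matrix is bounded below by its eigenvalues. -/
theorem Matrix.IsHermitian.mul_dotProduct_self_le {p : Type*} [Fintype p] [DecidableEq p]
    {A : Matrix p p ℝ} (hA : A.IsHermitian) {c : ℝ} (hc : ∀ l, c ≤ hA.eigenvalues l) (x : p → ℝ) :
    c * (x ⬝ᵥ x) ≤ x ⬝ᵥ (A *ᵥ x) := by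
  have hB : (A - algebraMap ℝ (Matrix p p ℝ) c).IsHermitian := by
    refine hA.sub ?_
    rw [Matrix.algebraMap_eq_diagonal]
    exact Matrix.isHermitian_diagonal _
  have hpsd : (A - algebraMap ℝ (Matrix p p ℝ) c).PosSemidef := by
    rw [hB.posSemidef_iff_eigenvalues_nonneg]
    intro i
    have h1 := hB.eigenvalues_mem_spectrum_real i
    rw [← spectrum.sub_singleton_eq, hA.spectrum_real_eq_range_eigenvalues] at h1
    obtain ⟨_, ⟨l, rfl⟩, _, rfl, h2⟩ := h1
    simp only [Pi.zero_apply]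
    simp only at h2
    linarith [hc l]
  have h := hpsd.dotProduct_mulVec_nonneg x
  rw [sub_mulVec, dotProduct_sub, star_trivial, Matrix.algebraMap_eq_diagonal] at h
  have e : (diagonal (algebraMap ℝ (p → ℝ) c)) *ᵥ x = c • x := by
    ext i
    simp [mulVec_diagonal]
  rw [e, dotProduct_smul, smul_eq_mul] at h
  linarith

theorem consRow_mulVec {O : Type*} {q : ℕ} (W : Matrix O (Fin q) ℝ) (d : O → ℝ)
    (b : Fin (q + 1) → ℝ) :
    (Matrix.of fun o => (Fin.cons (d o) (W o) : Fin (q + 1) → ℝ)) *ᵥ b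
      = b 0 • d + W *ᵥ (fun l => b l.succ) := by
  ext o
  simp [mulVec, dotProduct, Fin.sum_univ_succ, mul_comm]

theorem dotProduct_sq_le {q : Type*} [Fintype q] (x y : q → ℝ) :
    (x ⬝ᵥ y) ^ 2 ≤ (x ⬝ᵥ x) * (y ⬝ᵥ y) := by
  have := Finset.sum_mul_sq_le_sq_mul_sq Finset.univ x y
  simpa only [dotProduct, sq] using this

variable {p : Type*} [Fintype p] [DecidableEq p]

theorem isUnit_det_of_mul_dotProduct_self_le {Q : Matrix p p ℝ} {L : ℝ} (hL : 0 < L)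
    (hQ : ∀ x, L * (x ⬝ᵥ x) ≤ x ⬝ᵥ (Q *ᵥ x)) : IsUnit Q.det := by
  rw [isUnit_iff_ne_zero]
  intro h
  obtain ⟨v, hv, h0⟩ := Matrix.exists_mulVec_eq_zero_iff.2 h
  have h1 := hQ v
  rw [h0, dotProduct_zero] at h1
  have h2 : 0 ≤ v ⬝ᵥ v := by simpa using dotProduct_star_self_nonneg v
  have h3 : v ⬝ᵥ v = 0 := by nlinarith
  exact hv (dotProduct_self_eq_zero.1 h3)

/-- Bound for the bilinear form of the inverse of a matrix that is bounded below. -/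
theorem abs_inv_mulVec_dotProduct_le {Q : Matrix p p ℝ} {L : ℝ} (hL : 0 < L)
    (hQ : ∀ x, L * (x ⬝ᵥ x) ≤ x ⬝ᵥ (Q *ᵥ x)) (u v : p → ℝ) :
    |(Q⁻¹ *ᵥ u) ⬝ᵥ v| ≤ √(u ⬝ᵥ u) * √(v ⬝ᵥ v) / L := by
  have hdet := isUnit_det_of_mul_dotProduct_self_le hL hQ
  set a := Q⁻¹ *ᵥ u with ha
  have hQa : Q *ᵥ a = u := by rw [ha, mulVec_mulVec, mul_nonsing_inv _ hdet, one_mulVec]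
  have h1 := hQ a
  rw [hQa] at h1
  have hnn : ∀ x : p → ℝ, 0 ≤ x ⬝ᵥ x := fun x => by simpa using dotProduct_star_self_nonneg x
  have h2 := dotProduct_sq_le a u
  have h3 := dotProduct_sq_le a v
  -- From `L |a|² ≤ a ⬝ u ≤ |a| |u|` one gets `L |a| ≤ |u|`; Cauchy–Schwarz against `v` then
  -- finishes. Symmetry of `Q` plays no role.
  have h4 : L ^ 2 * (a ⬝ᵥ a) ≤ u ⬝ᵥ u := by
    by_cases h0 : a ⬝ᵥ a = 0
    · rw [h0, mul_zero]
      exact hnn u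
    · have hpos : 0 < a ⬝ᵥ a := lt_of_le_of_ne (hnn a) (Ne.symm h0)
      have h5 : (L * (a ⬝ᵥ a)) ^ 2 ≤ (a ⬝ᵥ a) * (u ⬝ᵥ u) :=
        (pow_le_pow_left₀ (by positivity) h1 2).trans h2
      refine le_of_mul_le_mul_right ?_ hpos
      nlinarith
  rw [le_div_iff₀ hL, ← Real.sqrt_mul (hnn u)]
  refine Real.le_sqrt_of_sq_le ?_
  rw [mul_pow, sq_abs]
  nlinarith [mul_le_mul_of_nonneg_right h4 (hnn v), mul_le_mul_of_nonneg_left h3 (sq_nonneg L)]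

variable {O : Type*} [Fintype O] {q : ℕ} (W : Matrix O (Fin q) ℝ) (d D : O → ℝ)

/-- The residual of `D` in a regression on the columns of `W`. -/
noncomputable def regressionResidual : O → ℝ := D - W *ᵥ ((Wᵀ * W)⁻¹ *ᵥ (Wᵀ *ᵥ D))

variable {W d D}

theorem transpose_mulVec_regressionResidual (hW : IsUnit (Wᵀ * W).det) :
    Wᵀ *ᵥ regressionResidual W D = 0 := by
  rw [regressionResidual, mulVec_sub, mulVec_mulVec, mulVec_mulVec, mul_nonsing_inv _ hW,
    one_mulVec, sub_self]

theorem regressionResidual_dotProduct (e : O → ℝ) :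
    regressionResidual W D ⬝ᵥ e = D ⬝ᵥ e - ((Wᵀ * W)⁻¹ *ᵥ (Wᵀ *ᵥ D)) ⬝ᵥ (Wᵀ *ᵥ e) := by
  rw [regressionResidual, sub_dotProduct, dotProduct_mulVec _ Wᵀ, vecMul_transpose]

theorem regressionResidual_dotProduct_mulVec (hW : IsUnit (Wᵀ * W).det) (x : Fin q → ℝ) :
    regressionResidual W D ⬝ᵥ (W *ᵥ x) = 0 := by
  rw [dotProduct_mulVec, ← mulVec_transpose, transpose_mulVec_regressionResidual hW,
    zero_dotProduct]

theorem regressionResidual_dotProduct_self (hW : IsUnit (Wᵀ * W).det) :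
    regressionResidual W D ⬝ᵥ regressionResidual W D
      = D ⬝ᵥ D - ((Wᵀ * W)⁻¹ *ᵥ (Wᵀ *ᵥ D)) ⬝ᵥ (Wᵀ *ᵥ D) := by
  rw [← regressionResidual_dotProduct D]
  conv_lhs => arg 2; rw [regressionResidual]
  rw [dotProduct_sub, regressionResidual_dotProduct_mulVec hW, sub_zero]

/-- The residual is orthogonal to the columns of `W`, and both `d - D` and `D` minus its residual
lie in their span. Pairing with the residual thus isolates the coefficient of `d`. -/
theorem regressionResidual_dotProduct_consRow_mulVec {x : Fin q → ℝ} (hW : IsUnit (Wᵀ * W).det)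
    (hd : d = D + W *ᵥ x)
    (b : Fin (q + 1) → ℝ) :
    regressionResidual W D
        ⬝ᵥ ((Matrix.of fun o => (Fin.cons (d o) (W o) : Fin (q + 1) → ℝ)) *ᵥ b)
      = (regressionResidual W D ⬝ᵥ regressionResidual W D) * b 0 := by
  rw [consRow_mulVec, dotProduct_add, dotProduct_smul,
    regressionResidual_dotProduct_mulVec hW, add_zero, hd, dotProduct_add,
    regressionResidual_dotProduct_mulVec hW, add_zero]
  conv_rhs => arg 1; arg 2; rw [regressionResidual]
  rw [dotProduct_sub, regressionResidual_dotProduct_mulVec hW, sub_zero, smul_eq_mul, mul_comm]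

/-- Being in the column space of the full design, the residual is fixed by the projection onto that
space. -/
theorem exists_consRow_mulVec_eq_regressionResidual {x : Fin q → ℝ} (hd : d = D + W *ᵥ x) :
    ∃ c : Fin (q + 1) → ℝ,
      (Matrix.of fun o => (Fin.cons (d o) (W o) : Fin (q + 1) → ℝ)) *ᵥ c
        = regressionResidual W D := by
  refine ⟨Fin.cons 1 (-(x + (Wᵀ * W)⁻¹ *ᵥ (Wᵀ *ᵥ D))), ?_⟩
  rw [consRow_mulVec, regressionResidual]
  simp only [Fin.cons_zero, Fin.cons_succ, hd]
  rw [one_smul, show (fun l => (-(x + (Wᵀ * W)⁻¹ *ᵥ (Wᵀ *ᵥ D))) l)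
    = -(x + (Wᵀ * W)⁻¹ *ᵥ (Wᵀ *ᵥ D)) from rfl, mulVec_neg, mulVec_add]
  abel

/-- The full design matrix has full rank if the controls have and the residual of the remaining
regressor does not vanish. -/
theorem isUnit_det_consRow_gram {x : Fin q → ℝ} (hW : IsUnit (Wᵀ * W).det)
    (hd : d = D + W *ᵥ x)
    (hr : regressionResidual W D ⬝ᵥ regressionResidual W D ≠ 0) :
    IsUnit ((Matrix.of fun o => (Fin.cons (d o) (W o) : Fin (q + 1) → ℝ))ᵀ
      * Matrix.of fun o => (Fin.cons (d o) (W o) : Fin (q + 1) → ℝ)).det := by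
  set X := Matrix.of fun o => (Fin.cons (d o) (W o) : Fin (q + 1) → ℝ) with hX
  rw [isUnit_iff_ne_zero]
  intro h
  obtain ⟨b, hb, h0⟩ := Matrix.exists_mulVec_eq_zero_iff.2 h
  have hXb : X *ᵥ b = 0 := by
    rw [← dotProduct_self_eq_zero, dotProduct_mulVec, ← mulVec_transpose, mulVec_mulVec, h0,
      zero_dotProduct]
  have hb0 : b 0 = 0 := by
    have h1 := regressionResidual_dotProduct_consRow_mulVec hW hd b
    rw [← hX, hXb, dotProduct_zero] at h1
    exact (mul_eq_zero.1 h1.symm).resolve_left hr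
  have hb1 : (fun l : Fin q => b l.succ) = 0 := by
    have h1 := consRow_mulVec W d b
    rw [← hX, hXb, hb0, zero_smul, zero_add] at h1
    have h2 : (Wᵀ * W) *ᵥ (fun l : Fin q => b l.succ) = 0 := by
      rw [← mulVec_mulVec, ← h1, mulVec_zero]
    have h3 := congrArg ((Wᵀ * W)⁻¹ *ᵥ ·) h2
    simpa only [mulVec_mulVec, nonsing_inv_mul _ hW, one_mulVec, mulVec_zero] using h3
  refine hb (funext fun l => ?_)
  refine Fin.cases hb0 (fun l => ?_) l
  exact congrFun hb1 l

/-- Frisch–Waugh–Lovell: the error of the least squares coefficient of `d`. -/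
theorem regressionResidual_mul_leastSquares_sub {x : Fin q → ℝ} (hW : IsUnit (Wᵀ * W).det)
    (hd : d = D + W *ᵥ x)
    (hX : IsUnit ((Matrix.of fun o => (Fin.cons (d o) (W o) : Fin (q + 1) → ℝ))ᵀ
      * Matrix.of fun o => (Fin.cons (d o) (W o) : Fin (q + 1) → ℝ)).det)
    (θ : Fin (q + 1) → ℝ) (e y : O → ℝ)
    (hy : y = (Matrix.of fun o => (Fin.cons (d o) (W o) : Fin (q + 1) → ℝ)) *ᵥ θ + e) :
    (regressionResidual W D ⬝ᵥ regressionResidual W D)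
      * ((((Matrix.of fun o => (Fin.cons (d o) (W o) : Fin (q + 1) → ℝ))ᵀ
      * Matrix.of fun o => (Fin.cons (d o) (W o) : Fin (q + 1) → ℝ))⁻¹
      *ᵥ ((Matrix.of fun o => (Fin.cons (d o) (W o) : Fin (q + 1) → ℝ))ᵀ *ᵥ y)) 0 - θ 0)
      = regressionResidual W D ⬝ᵥ e := by
  have hfwl := regressionResidual_dotProduct_consRow_mulVec hW hd
  obtain ⟨c, hc⟩ := exists_consRow_mulVec_eq_regressionResidual (W := W) hd
  set X := Matrix.of fun o => (Fin.cons (d o) (W o) : Fin (q + 1) → ℝ)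
  set b := ((Xᵀ * X)⁻¹ *ᵥ (Xᵀ *ᵥ y)) with hb
  have hb' : b = θ + (Xᵀ * X)⁻¹ *ᵥ (Xᵀ *ᵥ e) := by
    rw [hb, hy, mulVec_add, mulVec_mulVec, mulVec_add, mulVec_mulVec, nonsing_inv_mul _ hX,
      one_mulVec]
  have h1 : b 0 - θ 0 = ((Xᵀ * X)⁻¹ *ᵥ (Xᵀ *ᵥ e)) 0 := by rw [hb']; simp
  -- The left side becomes `r ⬝ X(XᵀX)⁻¹Xᵀe`. As `r = Xc`, the projection can be dropped, leaving `r
  -- ⬝ e`.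
  rw [h1, ← hfwl, ← hc]
  have tr : ∀ z, (X *ᵥ c) ⬝ᵥ z = c ⬝ᵥ (Xᵀ *ᵥ z) := fun z => by
    rw [dotProduct_mulVec, vecMul_transpose]
  rw [tr, tr, mulVec_mulVec, mulVec_mulVec, mul_nonsing_inv _ hX, one_mulVec]

end LeastSquares

/-! ### Measurability of matrix inverses. -/

section Measurability

variable {Ω : Type*} [MeasurableSpace Ω] {q : Type*} [Fintype q] [DecidableEq q]

theorem measurable_matrix_det {A : Ω → Matrix q q ℝ} (hA : ∀ i j, Measurable fun ω => A ω i j) :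
    Measurable fun ω => (A ω).det := by
  simp only [Matrix.det_apply]
  refine Finset.measurable_sum _ fun τ _ => ?_
  refine Measurable.const_smul ?_ _
  exact Finset.measurable_prod _ fun i _ => hA _ _

/-- By Cramer's rule the entries are quotients of determinants; on singular matrices the inverse
takes the value 0, so no exceptional set arises. -/
theorem measurable_matrix_inv_apply {A : Ω → Matrix q q ℝ}
    (hA : ∀ i j, Measurable fun ω => A ω i j) (i j : q) : Measurable fun ω => (A ω)⁻¹ i j := by
  simp only [Matrix.inv_def, Matrix.smul_apply, smul_eq_mul, Ring.inverse_eq_inv',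
    Matrix.adjugate_apply]
  refine (measurable_matrix_det hA).inv.mul (measurable_matrix_det fun a b => ?_)
  by_cases h : a = j
  · subst h
    simp
  · simp only [Matrix.updateRow_ne h]
    exact hA a b

end Measurability

/-! ### Measurability of the estimator and the pointwise bound on its expansion error. -/

namespace GroupSample

open Matrix

variable {Ω : Type*} [MeasurableSpace Ω] {k : ℕ} (M : GroupSample Ω k)

theorem measurable_X_apply (o : M.Obs) (l : Fin (k + 2)) : Measurable fun ω => M.X ω o l := by
  refine Fin.cases ?_ (fun l => ?_) l
  · exact M.measurable_d o.1
  · have := M.measurable_w o.1 o.2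
    change Measurable fun ω => M.w o.1 o.2 ω l
    fun_prop

theorem measurable_y (o : M.Obs) : Measurable (M.y o) := by
  have h1 := M.measurable_w o.1 o.2
  have h2 := M.measurable_d o.1
  have h3 := M.measurable_ε o.1 o.2
  unfold y
  fun_prop

theorem measurable_betaHat : Measurable M.betaHat := by
  unfold betaHat olsTheta
  simp only [mulVec, dotProduct, transpose_apply]
  refine Finset.measurable_sum _ fun l _ => Measurable.mul ?_ ?_
  · refine measurable_matrix_inv_apply (fun i j => ?_) 0 l
    simp only [mul_apply, transpose_apply]
    exact Finset.measurable_sum _ fun o _ =>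
      (M.measurable_X_apply o i).mul (M.measurable_X_apply o j)
  · exact Finset.measurable_sum _ fun o _ => (M.measurable_X_apply o l).mul (M.measurable_y o)

theorem measurable_errSum (j : Fin M.groups) : Measurable (M.errSum j) :=
  Finset.measurable_sum _ fun i _ => M.measurable_ε j i

theorem measurable_stdError (P : Measure Ω) (σd : ℝ) : Measurable (M.stdError P σd) :=
  (((M.measurable_betaHat).sub_const _).const_mul _).div_const _

theorem measurable_score (P : Measure Ω) (μd σd : ℝ) : Measurable (M.score P μd σd) := by
  have h1 := M.measurable_errSum
  have h2 := M.measurable_d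
  unfold score
  fun_prop

/-- `∑ (dⱼ - μ) wᵢⱼ`. -/
noncomputable def controlTreatment (μd : ℝ) (ω : Ω) : Fin (k + 1) → ℝ :=
  (M.W ω)ᵀ *ᵥ fun o => M.d o.1 ω - μd

/-- `∑ wᵢⱼ εᵢⱼ`. -/
noncomputable def controlError (ω : Ω) : Fin (k + 1) → ℝ :=
  (M.W ω)ᵀ *ᵥ fun o => M.ε o.1 o.2 ω

theorem controlTreatment_apply (μd : ℝ) (ω : Ω) (l : Fin (k + 1)) :
    M.controlTreatment μd ω l = ∑ j, (M.d j ω - μd) * ∑ i, M.w j i ω l := by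
  simp only [controlTreatment, mulVec, dotProduct, transpose_apply, W, of_apply,
    Fintype.sum_sigma, Finset.mul_sum]
  exact Finset.sum_congr rfl fun j _ => Finset.sum_congr rfl fun i _ => mul_comm _ _

theorem norm_smul_sum_error_smul_control (ω : Ω) :
    ‖(M.n : ℝ)⁻¹ • ∑ j, ∑ i, M.ε j i ω • M.w j i ω‖
      = (M.n : ℝ)⁻¹ * √(M.controlError ω ⬝ᵥ M.controlError ω) := by
  rw [norm_smul, EuclideanSpace.norm_eq, Real.norm_eq_abs, abs_of_nonneg (by positivity)]
  congr 2
  refine Finset.sum_congr rfl fun l _ => ?_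
  rw [Real.norm_eq_abs, sq_abs, sq]
  congr 1 <;>
  · simp only [controlError, mulVec, dotProduct, transpose_apply, W, of_apply, Fintype.sum_sigma,
      WithLp.ofLp_sum, WithLp.ofLp_smul, Finset.sum_apply, Pi.smul_apply, smul_eq_mul]
    exact Finset.sum_congr rfl fun j _ => Finset.sum_congr rfl fun i _ => mul_comm _ _

theorem mul_dotProduct_self_le_of_le_lambdaMin {ω : Ω} {c : ℝ} (hn : 0 < M.n)
    (hc : c ≤ M.lambdaMin ω) (x : Fin (k + 1) → ℝ) :
    (M.n : ℝ) * c * (x ⬝ᵥ x) ≤ x ⬝ᵥ (((M.W ω)ᵀ * M.W ω) *ᵥ x) := by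
  have hn' : (0 : ℝ) < M.n := by exact_mod_cast hn
  have h := (M.gram_isHermitian ω).mul_dotProduct_self_le
    (fun l => hc.trans (ciInf_le (Set.finite_range _).bddBelow l)) x
  rw [gram, smul_mulVec, dotProduct_smul, smul_eq_mul] at h
  rw [mul_assoc]
  calc (M.n : ℝ) * (c * (x ⬝ᵥ x)) ≤ M.n * ((M.n : ℝ)⁻¹ * (x ⬝ᵥ (((M.W ω)ᵀ * M.W ω) *ᵥ x))) := by
        gcongr
    _ = _ := by rw [mul_inv_cancel_left₀ hn'.ne']

/-- Relative error in replacing the residual variance of the treatment by its variance. -/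
noncomputable def varianceError (μd σd c : ℝ) (ω : Ω) : ℝ :=
  |(M.n : ℝ)⁻¹ * ∑ j, (M.size j : ℝ) * ((M.d j ω - μd) ^ 2 - σd ^ 2)| / σd ^ 2
    + (√(M.controlTreatment μd ω ⬝ᵥ M.controlTreatment μd ω) / M.n) ^ 2 / (c * σd ^ 2)

/-- Contribution of the estimated control coefficients to the estimation error. -/
noncomputable def controlContribution (P : Measure Ω) (μd σd c : ℝ) (ω : Ω) : ℝ :=
  √(M.controlTreatment μd ω ⬝ᵥ M.controlTreatment μd ω)
    * √(M.controlError ω ⬝ᵥ M.controlError ω) / (M.n * c * (√M.n * σd * M.S P))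

/-- With `T = (r ⬝ r) / (nσ²)`, Frisch–Waugh–Lovell reads `T * stdError = score - B / (√n σ S)`, so
`T * (stdError - score) = -(T - 1) * score - B / (√n σ S)`. The variance error bounds `|T - 1|`;
being at most `1 / 2`, it gives `T ≥ 1 / 2`, whence the factor 2. -/
theorem abs_stdError_sub_score_le (P : Measure Ω) {μd σd c : ℝ} {ω : Ω} (hn : 0 < M.n)
    (hS : 0 < M.S P) (hσ : 0 < σd) (hc : 0 < c) (hl : c ≤ M.lambdaMin ω)
    (hI : ∃ b : ℝ, b ≠ 0 ∧ ∀ j i, M.w j i ω 0 = b)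
    (hτ : M.varianceError μd σd c ω ≤ 1 / 2) :
    IsUnit ((M.X ω)ᵀ * M.X ω).det ∧
    |M.stdError P σd ω - M.score P μd σd ω|
      ≤ 2 * (M.varianceError μd σd c ω * |M.score P μd σd ω|
        + M.controlContribution P μd σd c ω) := by
  have hn' : (0 : ℝ) < M.n := by exact_mod_cast hn
  set N : ℝ := (M.n : ℝ) with hN
  set D : M.Obs → ℝ := fun o => M.d o.1 ω - μd with hD
  set e : M.Obs → ℝ := fun o => M.ε o.1 o.2 ω with he
  set u := M.controlTreatment μd ω with hu
  set v := M.controlError ω with hv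
  have hQ := M.mul_dotProduct_self_le_of_le_lambdaMin hn hl
  have hL : 0 < N * c := by positivity
  have hW := isUnit_det_of_mul_dotProduct_self_le hL hQ
  obtain ⟨b, hb, hI⟩ := hI
  -- The mean `μd` is `μd / b` times the constant control `b`, so treatment may be centred without
  -- changing the regression.
  have hd : (fun o : M.Obs => M.d o.1 ω) = D + M.W ω *ᵥ (Pi.single 0 (μd / b)) := by
    ext o
    simp only [Pi.add_apply, mulVec_single, hD, W]
    simp [hI]
    field_simp
    ring
  have hDD : D ⬝ᵥ D = ∑ j, (M.size j : ℝ) * (M.d j ω - μd) ^ 2 := by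
    simp [dotProduct, hD, Fintype.sum_sigma, sq]
  have hDe : D ⬝ᵥ e = ∑ j, (M.d j ω - μd) * M.errSum j ω := by
    simp [dotProduct, hD, he, Fintype.sum_sigma, errSum, Finset.mul_sum]
  have hrr := regressionResidual_dotProduct_self (D := D) hW
  have hre := regressionResidual_dotProduct (W := M.W ω) (D := D) e
  have huu := abs_inv_mulVec_dotProduct_le hL hQ u u
  have huv := abs_inv_mulVec_dotProduct_le hL hQ u v
  rw [hDD] at hrr
  rw [hDe] at hre
  change _ = _ - (((M.W ω)ᵀ * M.W ω)⁻¹ *ᵥ u) ⬝ᵥ u at hrr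
  change _ = _ - (((M.W ω)ᵀ * M.W ω)⁻¹ *ᵥ u) ⬝ᵥ v at hre
  set r := regressionResidual (M.W ω) D with hr
  set A := (((M.W ω)ᵀ * M.W ω)⁻¹ *ᵥ u) ⬝ᵥ u
  set B := (((M.W ω)ᵀ * M.W ω)⁻¹ *ᵥ u) ⬝ᵥ v
  set T := (r ⬝ᵥ r) / (N * σd ^ 2) with hT
  have hT1 : |T - 1| ≤ M.varianceError μd σd c ω := by
    have hsz : ∑ j, (M.size j : ℝ) * ((M.d j ω - μd) ^ 2 - σd ^ 2)
        = ∑ j, (M.size j : ℝ) * (M.d j ω - μd) ^ 2 - N * σd ^ 2 := by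
      simp only [mul_sub, Finset.sum_sub_distrib, ← Finset.sum_mul, hN, GroupSample.n]
      push_cast
      rfl
    have e1 : T - 1 = (N⁻¹ * ∑ j, (M.size j : ℝ) * ((M.d j ω - μd) ^ 2 - σd ^ 2)) / σd ^ 2
        - A / (N * σd ^ 2) := by
      rw [hT, hrr, hsz]
      field_simp
      ring
    rw [e1, varianceError]
    refine (abs_sub _ _).trans (add_le_add ?_ ?_)
    · rw [abs_div, abs_of_pos (show 0 < σd ^ 2 by positivity)]
    · rw [abs_div, abs_of_pos (show 0 < N * σd ^ 2 by positivity)]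
      calc |A| / (N * σd ^ 2) ≤ (√(u ⬝ᵥ u) * √(u ⬝ᵥ u) / (N * c)) / (N * σd ^ 2) := by gcongr
        _ = _ := by
          rw [← hN, ← hu]
          field_simp
  have hT2 : 1 / 2 ≤ T := by linarith [(abs_le.1 (hT1.trans hτ)).1]
  have hrr0 : r ⬝ᵥ r ≠ 0 := by
    intro h
    rw [hT, h, zero_div] at hT2
    norm_num at hT2
  have hX : IsUnit ((M.X ω)ᵀ * M.X ω).det := isUnit_det_consRow_gram hW hd hrr0
  refine ⟨hX, ?_⟩
  have hy : (fun o => M.y o ω) = M.X ω *ᵥ (Fin.cons M.β (fun l => M.γ l)) + e := by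
    have h := consRow_mulVec (M.W ω) (fun o => M.d o.1 ω) (Fin.cons M.β (fun l => M.γ l))
    change M.X ω *ᵥ _ = _ at h
    rw [h]
    ext o
    simp [y, he, W, mulVec, dotProduct, mul_comm]
  have hfwl : (r ⬝ᵥ r) * (M.betaHat ω - M.β) = r ⬝ᵥ e :=
    regressionResidual_mul_leastSquares_sub hW hd hX _ e _ hy
  have hsn : √N * √N = N := Real.mul_self_sqrt hn'.le
  have hsn0 : 0 < √N := Real.sqrt_pos.2 hn'
  have hTs : T * M.stdError P σd ω = M.score P μd σd ω - B / (√N * σd * M.S P) := by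
    have e1 : T * M.stdError P σd ω
        = ((r ⬝ᵥ r) * (M.betaHat ω - M.β)) * √N / (N * σd * M.S P) := by
      rw [hT, stdError, ← hN]
      field_simp
    rw [e1, hfwl, hre, score, ← hN]
    nth_rewrite 2 [← hsn]
    field_simp
  have hB : |B / (√N * σd * M.S P)| ≤ M.controlContribution P μd σd c ω := by
    rw [abs_div, abs_of_pos (show 0 < √N * σd * M.S P by positivity), controlContribution]
    exact (div_le_div_of_nonneg_right huv (by positivity)).trans_eq (div_div _ _ _)
  have hdiff : T * (M.stdError P σd ω - M.score P μd σd ω)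
      = -((T - 1) * M.score P μd σd ω) - B / (√N * σd * M.S P) := by
    rw [mul_sub, hTs]
    ring
  have h1 : T * |M.stdError P σd ω - M.score P μd σd ω|
      ≤ M.varianceError μd σd c ω * |M.score P μd σd ω| + M.controlContribution P μd σd c ω := by
    have hT0 : 0 < T := by linarith
    rw [← abs_of_pos hT0, ← abs_mul, hdiff]
    refine (abs_sub _ _).trans (add_le_add ?_ hB)
    rw [abs_neg, abs_mul]
    gcongr
  nlinarith [abs_nonneg (M.stdError P σd ω - M.score P μd σd ω)]

end GroupSample

/-! ### Elementary moment bounds. -/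

section Moments

variable {Ω : Type*} [MeasurableSpace Ω] {P : Measure Ω}

theorem MeasureTheory.MemLp.integrable_pow_four {X : Ω → ℝ} (hX : MemLp X 4 P) :
    Integrable (fun ω => X ω ^ 4) P := by
  have h := MemLp.integrable_norm_pow (p := 4) (by exact_mod_cast hX) (by norm_num)
  refine h.congr (Eventually.of_forall fun ω => ?_)
  simp only [Real.norm_eq_abs]
  exact (by decide : Even 4).pow_abs _

variable [IsProbabilityMeasure P]

/-- Combines `(x - μ)⁴ ≤ 8(x⁴ + μ⁴)` with `|μ| ≤ E|X| ≤ 1 + E X⁴ ≤ 1 + K`. -/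
theorem integral_sub_pow_four_le {X : Ω → ℝ} (hX : MemLp X 4 P) {μ K : ℝ}
    (hμ : ∫ ω, X ω ∂P = μ) (hK : ∫ ω, |X ω| ^ 4 ∂P ≤ K) :
    ∫ ω, (X ω - μ) ^ 4 ∂P ≤ 8 * (K + (1 + K) ^ 4) := by
  have h4 := hX.integrable_pow_four
  have hK' : ∫ ω, X ω ^ 4 ∂P ≤ K := by
    simpa only [(by decide : Even 4).pow_abs] using hK
  have hi : Integrable X P := hX.integrable (by norm_num)
  have hμK : |μ| ≤ 1 + K := by
    rw [← hμ]
    refine (abs_integral_le_integral_abs).trans ?_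
    have : ∫ ω, |X ω| ∂P ≤ ∫ ω, (1 + X ω ^ 4) ∂P := by
      refine integral_mono hi.abs ((integrable_const 1).add h4) fun ω => ?_
      simp only
      rw [← (by decide : Even 4).pow_abs]
      nlinarith [sq_nonneg (|X ω| ^ 2 - 1), sq_nonneg (|X ω| - 1), abs_nonneg (X ω)]
    rw [integral_add (integrable_const 1) h4] at this
    simp only [integral_const, probReal_univ, smul_eq_mul, mul_one] at this
    linarith
  have h8 : ∫ ω, (X ω - μ) ^ 4 ∂P ≤ ∫ ω, 8 * (X ω ^ 4 + μ ^ 4) ∂P := by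
    refine integral_mono (hX.sub (memLp_const μ)).integrable_pow_four
      ((h4.add (integrable_const _)).const_mul 8) fun ω => ?_
    simp only
    nlinarith [sq_nonneg (X ω + μ), sq_nonneg (X ω - μ), sq_nonneg ((X ω + μ) ^ 2),
      sq_nonneg (X ω ^ 2 - μ ^ 2), mul_nonneg (sq_nonneg (X ω + μ)) (sq_nonneg (X ω - μ)),
      mul_nonneg (sq_nonneg (X ω + μ)) (sq_nonneg (X ω)),
      mul_nonneg (sq_nonneg (X ω + μ)) (sq_nonneg μ)]
  rw [integral_const_mul, integral_add h4 (integrable_const _)] at h8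
  simp only [integral_const, probReal_univ, smul_eq_mul, one_mul] at h8
  have : μ ^ 4 ≤ (1 + K) ^ 4 := by
    rw [← (by decide : Even 4).pow_abs]
    exact pow_le_pow_left₀ (abs_nonneg _) hμK 4
  linarith

theorem integral_abs_pow_three_le {X : Ω → ℝ} (hX : MemLp X 4 P) :
    Integrable (fun ω => |X ω| ^ 3) P ∧ ∫ ω, |X ω| ^ 3 ∂P ≤ 1 + ∫ ω, X ω ^ 4 ∂P := by
  have h4 := hX.integrable_pow_four
  have h3 : Integrable (fun ω => |X ω| ^ 3) P := by
    have h := MemLp.integrable_norm_pow (p := 3) (f := X) (μ := P)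
      (hX.mono_exponent (by norm_num)) (by norm_num)
    simpa only [Real.norm_eq_abs] using h
  refine ⟨h3, ?_⟩
  have : ∫ ω, |X ω| ^ 3 ∂P ≤ ∫ ω, (1 + X ω ^ 4) ∂P := by
    refine integral_mono h3 ((integrable_const 1).add h4) fun ω => ?_
    simp only
    rw [← (by decide : Even 4).pow_abs (X ω)]
    rcases le_total (|X ω|) 1 with h | h
    · have := pow_le_one₀ (n := 3) (abs_nonneg (X ω)) h
      have : 0 ≤ |X ω| ^ 4 := by positivity
      linarith
    · have := pow_le_pow_right₀ h (show 3 ≤ 4 by norm_num)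
      linarith
  rwa [integral_add (integrable_const 1) h4, integral_const, probReal_univ, one_smul] at this

theorem integral_sq_le_one_add {X : Ω → ℝ} (hX : MemLp X 4 P) :
    ∫ ω, X ω ^ 2 ∂P ≤ 1 + ∫ ω, X ω ^ 4 ∂P := by
  have h4 := hX.integrable_pow_four
  have h2 : MemLp X 2 P := hX.mono_exponent (by norm_num)
  have : ∫ ω, X ω ^ 2 ∂P ≤ ∫ ω, (1 + X ω ^ 4) ∂P := by
    refine integral_mono h2.integrable_sq ((integrable_const 1).add h4) fun ω => ?_
    simp only
    nlinarith [sq_nonneg (X ω ^ 2 - 1), sq_nonneg (X ω ^ 2)]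
  rwa [integral_add (integrable_const 1) h4, integral_const, probReal_univ, one_smul] at this

theorem memLp_sq_sub_const {X : Ω → ℝ} (hX : MemLp X 4 P) (hm : Measurable X) (c : ℝ) :
    MemLp (fun ω => X ω ^ 2 - c) 2 P := by
  have : MemLp (fun ω => X ω ^ 2) 2 P := by
    rw [memLp_two_iff_integrable_sq (by fun_prop)]
    simpa only [← pow_mul] using hX.integrable_pow_four
  exact this.sub (memLp_const c)

end Moments

/-! ### Second moments of the group sums. -/

namespace GroupSample

open Matrix

variable {Ω : Type*} [MeasurableSpace Ω] {k : ℕ} (M : GroupSample Ω k) {P : Measure Ω}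

theorem kappa_sq : M.kappa ^ 2 = ∑ j, (M.size j : ℝ) ^ 2 := by
  rw [kappa, Real.sq_sqrt (by positivity)]

theorem kappa_pos (hn : 0 < M.n) : 0 < M.kappa := by
  rw [kappa, Real.sqrt_pos]
  obtain ⟨j, _, hj⟩ := Finset.exists_ne_zero_of_sum_ne_zero hn.ne'
  refine Finset.sum_pos' (fun _ _ => by positivity) ⟨j, Finset.mem_univ _, ?_⟩
  have : 0 < M.size j := Nat.pos_of_ne_zero hj
  positivity

theorem Ssq_nonneg : 0 ≤ M.Ssq P :=
  mul_nonneg (by positivity) (Finset.sum_nonneg fun _ _ => integral_nonneg fun _ => sq_nonneg _)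

/-- The treatment variables of one sample are independent with common mean and variance, and have
fourth moments. -/
structure HasTreatmentMoments (P : Measure Ω) (μd σd : ℝ) : Prop where
  indep : iIndepFun M.d P
  mean : ∀ j, ∫ ω, M.d j ω ∂P = μd
  variance : ∀ j, Var[M.d j; P] = σd ^ 2
  memLp : ∀ j, MemLp (M.d j) 4 P

variable {M} {μd σd : ℝ}

namespace HasTreatmentMoments

theorem integral_sub_sq (h : M.HasTreatmentMoments P μd σd) (j : Fin M.groups) :
    ∫ ω, (M.d j ω - μd) ^ 2 ∂P = σd ^ 2 := by
  rw [← h.variance j, variance_eq_integral (M.measurable_d j).aemeasurable, h.mean j]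

theorem indep_sub (h : M.HasTreatmentMoments P μd σd) :
    iIndepFun (fun j ω => M.d j ω - μd) P :=
  h.indep.comp (fun _ x => x - μd) fun _ => by fun_prop

variable [IsProbabilityMeasure P]

theorem memLp_sub (h : M.HasTreatmentMoments P μd σd) (j : Fin M.groups) :
    MemLp (fun ω => M.d j ω - μd) 4 P := (h.memLp j).sub (memLp_const μd)

theorem memLp_two_sub (h : M.HasTreatmentMoments P μd σd) (j : Fin M.groups) :
    MemLp (fun ω => M.d j ω - μd) 2 P := (h.memLp_sub j).mono_exponent (by norm_num)

theorem integral_sub (h : M.HasTreatmentMoments P μd σd) (j : Fin M.groups) :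
    ∫ ω, (M.d j ω - μd) ∂P = 0 := by
  rw [MeasureTheory.integral_sub ((h.memLp j).integrable (by norm_num)) (integrable_const _),
    h.mean j]
  simp

/-- Second moment of a sum over groups weighted by the centred treatment. -/
theorem integral_sq_sum_mul (h : M.HasTreatmentMoments P μd σd) {V : Fin M.groups → Ω → ℝ}
    (hVm : ∀ j, Measurable (V j)) (hV : ∀ j, MemLp (V j) 2 P)
    (hind : IndepFun (fun ω j => M.d j ω) (fun ω j => V j ω) P) :
    Integrable (fun ω => (∑ j, (M.d j ω - μd) * V j ω) ^ 2) P ∧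
    ∫ ω, (∑ j, (M.d j ω - μd) * V j ω) ^ 2 ∂P = σd ^ 2 * ∑ j, ∫ ω, V j ω ^ 2 ∂P := by
  have h1 := integral_sq_sum_mul_of_indepFun (Z := fun j ω => M.d j ω - μd) (V := V)
    (fun j => (M.measurable_d j).sub_const _) hVm h.memLp_two_sub hV h.indep_sub h.integral_sub
    (hind.comp (φ := fun (z : Fin M.groups → ℝ) j => z j - μd) (ψ := id) (by fun_prop)
      measurable_id)
  refine ⟨h1.1, ?_⟩
  rw [h1.2, Finset.mul_sum]
  exact Finset.sum_congr rfl fun j _ => by rw [h.integral_sub_sq]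

/-- Across groups the terms are uncorrelated because treatment is; within group `j` Cauchy–Schwarz
allows arbitrary dependence at the price `K nⱼ²`. Summing over groups produces `κ²`. -/
theorem integral_controlTreatment_sq_le (h : M.HasTreatmentMoments P μd σd)
    (hind : IndepFun (fun ω j => M.d j ω) (fun ω (o : M.Obs) => M.w o.1 o.2 ω) P) {K : ℝ}
    (hw : ∀ j i, MemLp (M.w j i) 2 P) (hK : ∀ j i, ∫ ω, ‖M.w j i ω‖ ^ 2 ∂P ≤ K) :
    Integrable (fun ω => M.controlTreatment μd ω ⬝ᵥ M.controlTreatment μd ω) P ∧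
    ∫ ω, M.controlTreatment μd ω ⬝ᵥ M.controlTreatment μd ω ∂P
      ≤ (k + 1) * (σd ^ 2 * (K * M.kappa ^ 2)) := by
  have hm : ∀ j i l, Measurable fun ω => M.w j i ω l := fun j i l => by
    have := M.measurable_w j i
    fun_prop
  have hle : ∀ j i l ω, (M.w j i ω l) ^ 2 ≤ ‖M.w j i ω‖ ^ 2 := fun j i l ω => by
    rw [← sq_abs]
    exact pow_le_pow_left₀ (abs_nonneg _) (by simpa using PiLp.norm_apply_le (M.w j i ω) l) 2
  have hwl : ∀ j i l, MemLp (fun ω => M.w j i ω l) 2 P := fun j i l => by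
    refine (hw j i).of_le (hm j i l).aestronglyMeasurable (Eventually.of_forall fun ω => ?_)
    exact PiLp.norm_apply_le (M.w j i ω) l
  have hwK : ∀ j i l, ∫ ω, (M.w j i ω l) ^ 2 ∂P ≤ K := fun j i l =>
    (integral_mono (hwl j i l).integrable_sq (hw j i).norm.integrable_sq (hle j i l)).trans
      (hK j i)
  have hV : ∀ l j, MemLp (fun ω => ∑ i, M.w j i ω l) 2 P := fun l j =>
    memLp_finsetSum _ fun i _ => hwl j i l
  have hVK : ∀ l j, ∫ ω, (∑ i, M.w j i ω l) ^ 2 ∂P ≤ K * (M.size j : ℝ) ^ 2 := by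
    intro l j
    have hi : Integrable (fun ω => (M.size j : ℝ) * ∑ i, (M.w j i ω l) ^ 2) P :=
      (integrable_finsetSum _ fun i _ => (hwl j i l).integrable_sq).const_mul _
    calc ∫ ω, (∑ i, M.w j i ω l) ^ 2 ∂P
        ≤ ∫ ω, (M.size j : ℝ) * ∑ i, (M.w j i ω l) ^ 2 ∂P := by
          refine integral_mono (hV l j).integrable_sq hi fun ω => ?_
          simpa using sq_sum_le_card_mul_sum_sq (s := Finset.univ) (f := fun i => M.w j i ω l)
      _ = (M.size j : ℝ) * ∑ i, ∫ ω, (M.w j i ω l) ^ 2 ∂P := by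
          rw [integral_const_mul, integral_finsetSum _ fun i _ => (hwl j i l).integrable_sq]
      _ ≤ (M.size j : ℝ) * ∑ _i : Fin (M.size j), K := by
          gcongr with i
          exact hwK j i l
      _ = _ := by simp; ring
  have hl := fun l => h.integral_sq_sum_mul (V := fun j ω => ∑ i, M.w j i ω l)
    (fun j => Finset.measurable_sum _ fun i _ => hm j i l) (hV l)
    (hind.comp (φ := id)
      (ψ := fun (w : M.Obs → EuclideanSpace ℝ (Fin (k + 1))) j => ∑ i, w ⟨j, i⟩ l)
      measurable_id (by fun_prop))
  simp only [dotProduct, controlTreatment_apply, ← sq]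
  refine ⟨integrable_finsetSum _ fun l _ => (hl l).1, ?_⟩
  rw [integral_finsetSum _ fun l _ => (hl l).1]
  calc _ ≤ ∑ _l : Fin (k + 1), σd ^ 2 * (K * M.kappa ^ 2) := by
        refine Finset.sum_le_sum fun l _ => ?_
        rw [(hl l).2, kappa_sq]
        refine mul_le_mul_of_nonneg_left ?_ (sq_nonneg _)
        rw [Finset.mul_sum]
        exact Finset.sum_le_sum fun j _ => hVK l j
    _ = _ := by simp

/-- The same variance identity, with deterministic weights `nⱼ` and the independent centred
variables `(dⱼ - μd)² - σd²`, whose variance is at most the fourth moment. -/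
theorem integral_sum_size_mul_sq_sub_le (h : M.HasTreatmentMoments P μd σd) {C : ℝ}
    (hC : ∀ j, ∫ ω, (M.d j ω - μd) ^ 4 ∂P ≤ C) :
    Integrable (fun ω =>
      ((M.n : ℝ)⁻¹ * ∑ j, (M.size j : ℝ) * ((M.d j ω - μd) ^ 2 - σd ^ 2)) ^ 2) P ∧
    ∫ ω, ((M.n : ℝ)⁻¹ * ∑ j, (M.size j : ℝ) * ((M.d j ω - μd) ^ 2 - σd ^ 2)) ^ 2 ∂P
      ≤ C * (M.kappa / M.n) ^ 2 := by
  have h2 : ∀ j, Integrable (fun ω => (M.d j ω - μd) ^ 2) P := fun j =>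
    (h.memLp_two_sub j).integrable_sq
  have h4 : ∀ j, Integrable (fun ω => (M.d j ω - μd) ^ 4) P := fun j =>
    (h.memLp_sub j).integrable_pow_four
  have h1 := integral_sq_sum_mul_of_indepFun (P := P)
    (Z := fun j ω => (M.d j ω - μd) ^ 2 - σd ^ 2) (V := fun j _ => (M.size j : ℝ))
    (fun j => (((M.measurable_d j).sub_const _).pow_const 2).sub_const _)
    (fun j => measurable_const)
    (fun j => memLp_sq_sub_const (h.memLp_sub j) ((M.measurable_d j).sub_const _) _)
    (fun j => memLp_const _)
    (h.indep.comp (fun _ x => (x - μd) ^ 2 - σd ^ 2) fun _ => by fun_prop)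
    (fun j => by
      rw [MeasureTheory.integral_sub (h2 j) (integrable_const _), h.integral_sub_sq]
      simp)
    (indepFun_const_right _ _)
  have hZ : ∀ j, ∫ ω, ((M.d j ω - μd) ^ 2 - σd ^ 2) ^ 2 ∂P ≤ C := by
    intro j
    have e : ∀ ω, ((M.d j ω - μd) ^ 2 - σd ^ 2) ^ 2
        = (M.d j ω - μd) ^ 4 - 2 * σd ^ 2 * (M.d j ω - μd) ^ 2 + σd ^ 4 := fun ω => by ring
    simp only [e]
    have h42 : Integrable (fun ω => (M.d j ω - μd) ^ 4 - 2 * σd ^ 2 * (M.d j ω - μd) ^ 2) P :=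
      (h4 j).sub ((h2 j).const_mul _)
    rw [integral_add h42 (integrable_const _),
      MeasureTheory.integral_sub (h4 j) ((h2 j).const_mul _), integral_const_mul, h.integral_sub_sq]
    simp only [integral_const, probReal_univ, smul_eq_mul, one_mul]
    nlinarith [hC j, sq_nonneg (σd ^ 2)]
  have e : ∀ ω, ((M.n : ℝ)⁻¹ * ∑ j, (M.size j : ℝ) * ((M.d j ω - μd) ^ 2 - σd ^ 2)) ^ 2
      = ((M.n : ℝ)⁻¹) ^ 2 * (∑ j, ((M.d j ω - μd) ^ 2 - σd ^ 2) * (M.size j : ℝ)) ^ 2 := fun ω => by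
    rw [mul_pow]
    congr 2
    exact Finset.sum_congr rfl fun j _ => mul_comm _ _
  simp only [e]
  refine ⟨h1.1.const_mul _, ?_⟩
  rw [integral_const_mul, h1.2]
  calc _ ≤ ((M.n : ℝ)⁻¹) ^ 2 * ∑ j, C * (M.size j : ℝ) ^ 2 := by
        refine mul_le_mul_of_nonneg_left (Finset.sum_le_sum fun j _ => ?_) (by positivity)
        simp only [integral_const, probReal_univ, smul_eq_mul, one_mul]
        exact mul_le_mul_of_nonneg_right (hZ j) (sq_nonneg _)
    _ = _ := by
        rw [← Finset.mul_sum, ← kappa_sq, div_eq_mul_inv]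
        ring

theorem integral_score_sq (h : M.HasTreatmentMoments P μd σd)
    (hind : IndepFun (fun ω j => M.d j ω) (fun ω (o : M.Obs) => M.ε o.1 o.2 ω) P)
    (he : ∀ j, MemLp (M.errSum j) 2 P) (hn : 0 < M.n) (hS : 0 < M.S P) (hσ : 0 < σd) :
    ∫ ω, M.score P μd σd ω ^ 2 ∂P = 1 := by
  have hl := h.integral_sq_sum_mul (V := M.errSum) M.measurable_errSum he
    (hind.comp (φ := id) (ψ := fun (e : M.Obs → ℝ) j => ∑ i, e ⟨j, i⟩)
      measurable_id (by fun_prop))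
  have hn' : (0 : ℝ) < M.n := by exact_mod_cast hn
  simp only [score, div_pow, mul_pow]
  rw [integral_div, integral_const_mul, hl.2, inv_pow, Real.sq_sqrt hn'.le]
  have : M.S P ^ 2 = (M.n : ℝ)⁻¹ * ∑ j, ∫ ω, M.errSum j ω ^ 2 ∂P := by
    rw [S, Real.sq_sqrt M.Ssq_nonneg, Ssq]
  rw [mul_left_comm, ← this]
  exact div_self (by positivity)

theorem integrable_score_sq (h : M.HasTreatmentMoments P μd σd)
    (hind : IndepFun (fun ω j => M.d j ω) (fun ω (o : M.Obs) => M.ε o.1 o.2 ω) P)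
    (he : ∀ j, MemLp (M.errSum j) 2 P) : Integrable (fun ω => M.score P μd σd ω ^ 2) P := by
  have hl := h.integral_sq_sum_mul (V := M.errSum) M.measurable_errSum he
    (hind.comp (φ := id) (ψ := fun (e : M.Obs → ℝ) j => ∑ i, e ⟨j, i⟩)
      measurable_id (by fun_prop))
  simp only [score, div_pow, mul_pow]
  exact (hl.1.const_mul _).div_const _

end HasTreatmentMoments

end GroupSample

/-! ### Stochastic orders of the remainders and the limit of the score. -/

section Asymptotics

open Matrix

variable {k : ℕ} {Ω : ℕ → Type*} [∀ m, MeasurableSpace (Ω m)] {P : ∀ m, Measure (Ω m)}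
  {M : ∀ m, GroupSample (Ω m) k} {μd σd : ℕ → ℝ}

theorem TreatmentConditions.hasTreatmentMoments (hD : TreatmentConditions P M μd σd) (m : ℕ) :
    (M m).HasTreatmentMoments (P m) (μd m) (σd m) where
  indep := hD.indep m
  mean := hD.mean m
  variance := hD.variance m
  memLp j := by
    obtain ⟨K, _, h⟩ := hD.moment
    exact (h m j).1

theorem TreatmentConditions.exists_le_sd (hD : TreatmentConditions P M μd σd) :
    ∃ s : ℝ, 0 < s ∧ ∀ m, s ≤ σd m := by
  obtain ⟨K, hK, h⟩ := hD.variance_lower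
  exact ⟨√K⁻¹, by positivity, fun m => (Real.sqrt_le_left (hD.sd_nonneg m)).2 (h m)⟩

theorem ControlConditions.exists_tendsto_measure_lambdaMin_lt (hW : ControlConditions P M) :
    ∃ c : ℝ, 0 < c ∧ Tendsto (fun m => P m {ω | (M m).lambdaMin ω < c}) atTop (𝓝 0) := by
  obtain ⟨K, hK, r, hr, h⟩ := hW.eigenvalue
  -- If `λ_min` falls below half of `K⁻¹`, the remainder is below `-K⁻¹ / 2`, so exceeds `K⁻¹ / 4`
  -- in absolute value.
  refine ⟨K⁻¹ / 2, by positivity, ?_⟩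
  refine tendsto_of_tendsto_of_tendsto_of_le_of_le tendsto_const_nhds
    (hr (K⁻¹ / 4) (by positivity)) (fun _ => zero_le) fun m => measure_mono fun ω hω => ?_
  have hK' : 0 < K⁻¹ := by positivity
  simp only [Set.mem_ofPred_eq, Real.norm_eq_abs] at hω ⊢
  linarith [h m ω, neg_abs_le (r m ω)]

theorem Ssq_eq_sum_variance (hE : ErrorMoments P M) (m : ℕ) :
    (M m).Ssq (P m) = ((M m).n : ℝ)⁻¹ * ∑ j, Var[(M m).errSum j; P m] := by
  rw [GroupSample.Ssq]
  congr 1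
  refine Finset.sum_congr rfl fun j _ => ?_
  have h0 : ∫ ω, (M m).errSum j ω ∂(P m) = 0 := by
    simp only [GroupSample.errSum]
    rw [integral_finsetSum _ fun i _ => hE.integrable m j i]
    exact Finset.sum_eq_zero fun i _ => hE.mean_zero m j i
  rw [variance_eq_integral ((M m).measurable_errSum j).aemeasurable, h0]
  simp

variable [∀ m, IsProbabilityMeasure (P m)]

/-- If `n` or `S` vanishes, the inverses in `lln` are 0 by convention. The statistic there is then
identically `-1`, which is not small in probability. -/
theorem ErrorConditions.eventually_pos (hS : ErrorConditions P M) :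
    ∀ᶠ m in atTop, 0 < (M m).n ∧ 0 < (M m).S (P m) := by
  have h := ENNReal.tendsto_nhds_zero.1 (hS.lln (1 / 2) (by norm_num)) (1 / 2) (by simp)
  filter_upwards [h] with m hm
  by_contra hc
  have hz : ((M m).Ssq (P m))⁻¹ * ((M m).n : ℝ)⁻¹ = 0 := by
    by_cases hn : (M m).n = 0
    · simp [hn]
    · have hS0 : (M m).S (P m) = 0 := le_antisymm
        (not_lt.1 fun h => hc ⟨Nat.pos_of_ne_zero hn, h⟩) (Real.sqrt_nonneg _)
      rw [GroupSample.S, Real.sqrt_eq_zero (M m).Ssq_nonneg] at hS0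
      simp [hS0]
  have : {ω : Ω m | (1 / 2 : ℝ) * 1 < ‖((M m).Ssq (P m))⁻¹ * ((M m).n : ℝ)⁻¹
      * ∑ j, (M m).errSum j ω ^ 2 - 1‖} = Set.univ := by
    ext ω
    simp only [hz, Set.mem_ofPred_eq, Set.mem_univ, iff_true]
    norm_num
  rw [this, measure_univ] at hm
  norm_num at hm

theorem TreatmentConditions.exists_integral_pow_four_le (hD : TreatmentConditions P M μd σd) :
    ∃ C : ℝ, 0 ≤ C ∧ ∀ m j, ∫ ω, ((M m).d j ω - μd m) ^ 4 ∂(P m) ≤ C := by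
  obtain ⟨K, hK, h⟩ := hD.moment
  exact ⟨8 * (K + (1 + K) ^ 4), by positivity, fun m j =>
    integral_sub_pow_four_le (h m j).1 (hD.mean m j) (h m j).2⟩

theorem isBigOp_controlTreatment (hW : ControlConditions P M)
    (hD : TreatmentConditions P M μd σd) (hS : ErrorConditions P M) :
    IsBigOp P fun m ω => √((M m).controlTreatment (μd m) ω ⬝ᵥ (M m).controlTreatment (μd m) ω)
      / (M m).kappa := by
  obtain ⟨K, hK, hw⟩ := hW.moment
  obtain ⟨C, hC0, hC⟩ := hD.exists_integral_pow_four_le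
  have h := fun m => (hD.hasTreatmentMoments m).integral_controlTreatment_sq_le
    (hD.indep_controls m) (fun j i => (hw m j i).1) (fun j i => (hw m j i).2)
  have e : ∀ m ω, (√((M m).controlTreatment (μd m) ω ⬝ᵥ (M m).controlTreatment (μd m) ω)
      / (M m).kappa) ^ 2
      = ((M m).controlTreatment (μd m) ω ⬝ᵥ (M m).controlTreatment (μd m) ω)
        / (M m).kappa ^ 2 := fun m ω => by
    have h0 : 0 ≤ (M m).controlTreatment (μd m) ω ⬝ᵥ (M m).controlTreatment (μd m) ω :=
      Finset.sum_nonneg fun _ _ => mul_self_nonneg _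
    rw [div_pow, Real.sq_sqrt h0]
  refine isBigOp_of_integral_sq (C := (k + 1) * ((1 + C) * K)) (fun m => ?_) ?_
  · simp only [e]
    exact (h m).1.div_const _
  · filter_upwards [hS.eventually_pos] with m hm
    have hκ := (M m).kappa_pos hm.1
    simp only [e]
    rw [integral_div, div_le_iff₀ (by positivity)]
    refine (h m).2.trans ?_
    have hσ : σd m ^ 2 ≤ 1 + C := by
      -- The moment bounds control `σd m` only through some group; `n > 0` supplies one.
      obtain ⟨j, _, _⟩ := Finset.exists_ne_zero_of_sum_ne_zero hm.1.ne'
      rw [← (hD.hasTreatmentMoments m).integral_sub_sq j]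
      exact (integral_sq_le_one_add ((hD.hasTreatmentMoments m).memLp_sub j)).trans
        (by linarith [hC m j])
    calc ((k : ℝ) + 1) * (σd m ^ 2 * (K * (M m).kappa ^ 2))
        ≤ (k + 1) * ((1 + C) * (K * (M m).kappa ^ 2)) := by gcongr
      _ = _ := by ring

theorem isLittleOp_controlError (hS : ErrorConditions P M) :
    IsLittleOp P (fun m ω => √((M m).controlError ω ⬝ᵥ (M m).controlError ω) * (M m).kappa
      / ((M m).n * (√(M m).n * (M m).S (P m)))) fun _ => 1 := by
  intro δ hδ
  refine (hS.orthogonality δ hδ).congr' ?_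
  filter_upwards [hS.eventually_pos] with m hm
  have hκ := (M m).kappa_pos hm.1
  have hn : (0 : ℝ) < (M m).n := by exact_mod_cast hm.1
  have hS0 := hm.2
  congr 1
  ext ω
  simp only [Set.mem_ofPred_eq]
  rw [(M m).norm_smul_sum_error_smul_control, Real.norm_eq_abs, abs_of_nonneg (by positivity),
    ← mul_div_assoc, div_lt_iff₀ hκ, mul_one, lt_div_iff₀ (by positivity)]
  have e : ((M m).n : ℝ)⁻¹ * √((M m).controlError ω ⬝ᵥ (M m).controlError ω) * (M m).kappa
      = (√((M m).controlError ω ⬝ᵥ (M m).controlError ω) * (M m).kappa) / (M m).n := by ring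
  rw [e, lt_div_iff₀ hn]
  constructor <;> intro h <;> linarith

/-- The first part has second moment `O((κ/n)²)`. In the second, `|u|/n = (|u|/κ)(κ/n)` is `O_p(1)
o(1)`. -/
theorem isLittleOp_varianceError (hW : ControlConditions P M)
    (hD : TreatmentConditions P M μd σd) (hS : ErrorConditions P M) {c : ℝ} (hc : 0 < c) :
    IsLittleOp P (fun m ω => (M m).varianceError (μd m) (σd m) c ω) fun _ => 1 := by
  obtain ⟨C, hC0, hC⟩ := hD.exists_integral_pow_four_le
  obtain ⟨s, hs, hσ⟩ := hD.exists_le_sd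
  have hσ0 : ∀ m, 0 < σd m := fun m => hs.trans_le (hσ m)
  have h1 := fun m => (hD.hasTreatmentMoments m).integral_sum_size_mul_sq_sub_le (hC m)
  have hq : IsLittleOp P (fun m ω => ((M m).n : ℝ)⁻¹
      * ∑ j, ((M m).size j : ℝ) * (((M m).d j ω - μd m) ^ 2 - σd m ^ 2)) fun _ => 1 := by
    refine isLittleOp_of_integral_sq (fun m => (h1 m).1) ?_
    refine squeeze_zero (fun m => integral_nonneg fun _ => sq_nonneg _) (fun m => (h1 m).2) ?_
    simpa using (hS.sizes.pow 2).const_mul C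
  have hr : IsLittleOp P (fun m (_ : Ω m) => (M m).kappa / (M m).n) fun _ => 1 := by
    refine isLittleOp_of_integral_sq (fun m => integrable_const _) ?_
    simpa using hS.sizes.pow 2
  have hu := isBigOp_controlTreatment hW hD hS
  have hur := hu.mul_littleOp hr
  have hur2 := hur.isBigOp.mul_littleOp hur
  have b1 : IsBigOp P fun m (_ : Ω m) => (σd m ^ 2)⁻¹ := isBigOp_const (C := (s ^ 2)⁻¹) fun m => by
    rw [abs_of_pos (by have := hσ0 m; positivity)]
    have := hσ m
    gcongr
  have b2 : IsBigOp P fun m (_ : Ω m) => (c * σd m ^ 2)⁻¹ :=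
    isBigOp_const (C := (c * s ^ 2)⁻¹) fun m => by
      rw [abs_of_pos (by have := hσ0 m; positivity)]
      have := hσ m
      gcongr
  have a1 := b1.mul_littleOp hq
  have a1' : IsLittleOp P (fun m ω => |(σd m ^ 2)⁻¹ * (((M m).n : ℝ)⁻¹
      * ∑ j, ((M m).size j : ℝ) * (((M m).d j ω - μd m) ^ 2 - σd m ^ 2))|) fun _ => 1 :=
    a1.of_abs_le (fun _ => ∅) (by simp) (Eventually.of_forall fun m ω _ => (abs_abs _).le)
  refine (a1'.add (b2.mul_littleOp hur2)).of_abs_le (fun _ => ∅) (by simp) ?_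
  filter_upwards [hS.eventually_pos] with m hm ω _
  have hκ := (M m).kappa_pos hm.1
  refine le_of_eq ?_
  congr 1
  have hσm := hσ0 m
  rw [GroupSample.varianceError, abs_mul (σd m ^ 2)⁻¹,
    abs_of_pos (show 0 < (σd m ^ 2)⁻¹ by positivity)]
  congr 1
  · exact div_eq_inv_mul _ _
  · field_simp

/-- The factors `|u|/κ = O_p(1)` and `κ|v|/(n^{3/2} S) = o_p(1)` are multiplied, and `κ` cancels. -/
theorem isLittleOp_controlContribution (hW : ControlConditions P M)
    (hD : TreatmentConditions P M μd σd) (hS : ErrorConditions P M) {c : ℝ} (hc : 0 < c) :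
    IsLittleOp P (fun m ω => (M m).controlContribution (P m) (μd m) (σd m) c ω) fun _ => 1 := by
  obtain ⟨s, hs, hσ⟩ := hD.exists_le_sd
  have hσ0 : ∀ m, 0 < σd m := fun m => hs.trans_le (hσ m)
  have b : IsBigOp P fun m (_ : Ω m) => (c * σd m)⁻¹ :=
    isBigOp_const (C := (c * s)⁻¹) fun m => by
      rw [abs_of_pos (by have := hσ0 m; positivity)]
      have := hσ m
      gcongr
  refine (b.mul_littleOp ((isBigOp_controlTreatment hW hD hS).mul_littleOp
    (isLittleOp_controlError hS))).of_abs_le (fun _ => ∅) (by simp) ?_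
  filter_upwards [hS.eventually_pos] with m hm ω _
  have hκ := (M m).kappa_pos hm.1
  refine le_of_eq ?_
  congr 1
  rw [GroupSample.controlContribution]
  field_simp

theorem isBigOp_score (hE : ErrorMoments P M) (hD : TreatmentConditions P M μd σd)
    (hS : ErrorConditions P M) :
    IsBigOp P fun m ω => (M m).score (P m) (μd m) (σd m) ω := by
  obtain ⟨s, hs, hσ⟩ := hD.exists_le_sd
  refine isBigOp_of_integral_sq (C := 1) (fun m => (hD.hasTreatmentMoments m).integrable_score_sq
    (hD.indep_errors m) (hE.sq_integrable m)) ?_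
  filter_upwards [hS.eventually_pos] with m hm
  exact ((hD.hasTreatmentMoments m).integral_score_sq (hD.indep_errors m) (hE.sq_integrable m)
    hm.1 hm.2 (hs.trans_le (hσ m))).le

theorem leastSquares_expansion (hE : ErrorMoments P M) (hW : ControlConditions P M)
    (hD : TreatmentConditions P M μd σd) (hS : ErrorConditions P M) :
    Tendsto (fun m => P m {ω | ¬ IsUnit (((M m).X ω).transpose * (M m).X ω).det}) atTop (𝓝 0) ∧
    IsLittleOp P (fun m ω => (M m).stdError (P m) (σd m) ω - (M m).score (P m) (μd m) (σd m) ω)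
      fun _ => 1 := by
  obtain ⟨s, hs, hσ⟩ := hD.exists_le_sd
  obtain ⟨c, hc, hl⟩ := hW.exists_tendsto_measure_lambdaMin_lt
  have hτ := isLittleOp_varianceError hW hD hS hc
  have hρ := isLittleOp_controlContribution hW hD hS hc
  -- Off this event the two hypotheses of the pointwise bound hold: `λ_min ≥ c` and variance error
  -- at most `1 / 2`.
  let B : ∀ m, Set (Ω m) := fun m => {ω | (M m).lambdaMin ω < c}
    ∪ {ω | 1 / 2 * 1 < ‖(M m).varianceError (μd m) (σd m) c ω‖}
  have hB : Tendsto (fun m => P m (B m)) atTop (𝓝 0) := by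
    have h := hl.add (hτ (1 / 2) (by norm_num))
    rw [add_zero] at h
    exact tendsto_of_tendsto_of_tendsto_of_le_of_le tendsto_const_nhds h
      (fun _ => zero_le) fun m => measure_union_le _ _
  have key : ∀ᶠ m in atTop, ∀ ω, ω ∉ B m → IsUnit (((M m).X ω)ᵀ * (M m).X ω).det ∧
      |(M m).stdError (P m) (σd m) ω - (M m).score (P m) (μd m) (σd m) ω|
      ≤ 2 * ((M m).varianceError (μd m) (σd m) c ω * |(M m).score (P m) (μd m) (σd m) ω|
        + (M m).controlContribution (P m) (μd m) (σd m) c ω) := by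
    filter_upwards [hS.eventually_pos] with m hm ω hω
    simp only [B, Set.mem_union, Set.mem_ofPred_eq, not_or, not_lt, mul_one] at hω
    obtain ⟨b, hb, hI⟩ := hW.intercept m
    exact (M m).abs_stdError_sub_score_le (P m) hm.1 hm.2 (hs.trans_le (hσ m)) hc hω.1
      ⟨b, hb, fun j i => hI j i ω⟩ ((le_abs_self _).trans hω.2)
  constructor
  · refine tendsto_of_tendsto_of_tendsto_of_le_of_le' tendsto_const_nhds hB
      (Eventually.of_forall fun _ => zero_le) ?_
    filter_upwards [key] with m hm
    refine measure_mono fun ω hω => ?_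
    by_contra hc
    exact hω (hm ω hc).1
  · have b2 : IsBigOp P fun m (_ : Ω m) => (2 : ℝ) := isBigOp_const (C := 2) fun m => by norm_num
    have hsc : IsBigOp P fun m ω => |(M m).score (P m) (μd m) (σd m) ω| :=
      (isBigOp_score hE hD hS).of_abs_le (Eventually.of_forall fun m ω => (abs_abs _).le)
    refine (b2.mul_littleOp ((hsc.mul_littleOp hτ).add hρ)).of_abs_le B hB ?_
    filter_upwards [key] with m hm ω hω
    refine (hm ω hω).2.trans ((le_of_eq ?_).trans (le_abs_self _))
    ring

/-- A maximum is at most a sum: one weight above `η` already pushes the Lyapunov sum above `η^{2+δ}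
S^{2+δ}`. -/
theorem tendsto_measure_exists_lt_abs_errSum (hS : ErrorConditions P M) {η : ℝ} (hη : 0 < η) :
    Tendsto (fun m => P m {ω | ∃ j, η < |(M m).errSum j ω / (√(M m).n * (M m).S (P m))|})
      atTop (𝓝 0) := by
  obtain ⟨δ, hδ, _, h⟩ := hS.lyapunov
  refine tendsto_of_tendsto_of_tendsto_of_le_of_le' tendsto_const_nhds
    (h (η ^ (2 + δ)) (by positivity)) (Eventually.of_forall fun _ => zero_le) ?_
  filter_upwards [hS.eventually_pos] with m hm
  have hn : (0 : ℝ) < (M m).n := by exact_mod_cast hm.1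
  have hS0 := hm.2
  refine measure_mono ?_
  rintro ω ⟨j, hj⟩
  rw [abs_div, abs_of_pos (show 0 < √((M m).n : ℝ) * (M m).S (P m) by positivity),
    lt_div_iff₀ (by positivity)] at hj
  have h1 := Real.rpow_lt_rpow (by positivity) hj (show 0 < 2 + δ by positivity)
  rw [Real.mul_rpow (by positivity) (by positivity), Real.mul_rpow (by positivity) hS0.le,
    Real.sqrt_eq_rpow, ← Real.rpow_mul hn.le] at h1
  have h2 : |(M m).errSum j ω| ^ (2 + δ) ≤ ∑ j, |(M m).errSum j ω| ^ (2 + δ) :=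
    Finset.single_le_sum (f := fun j => |(M m).errSum j ω| ^ (2 + δ))
      (fun _ _ => by positivity) (Finset.mem_univ j)
  have hpow : ((M m).n : ℝ) ^ (-1 - δ / 2) * ((M m).n : ℝ) ^ (1 / 2 * (2 + δ)) = 1 := by
    rw [← Real.rpow_add hn, show -1 - δ / 2 + 1 / 2 * (2 + δ) = 0 by ring, Real.rpow_zero]
  simp only [Set.mem_ofPred_eq]
  rw [Real.norm_eq_abs, abs_of_nonneg (by positivity)]
  have hp : 0 < ((M m).n : ℝ) ^ (-1 - δ / 2) := by positivity
  calc η ^ (2 + δ) * (M m).S (P m) ^ (2 + δ)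
      = ((M m).n : ℝ) ^ (-1 - δ / 2)
        * (η ^ (2 + δ) * (((M m).n : ℝ) ^ (1 / 2 * (2 + δ)) * (M m).S (P m) ^ (2 + δ))) := by
        linear_combination -(η ^ (2 + δ) * (M m).S (P m) ^ (2 + δ)) * hpow
    _ < ((M m).n : ℝ) ^ (-1 - δ / 2) * |(M m).errSum j ω| ^ (2 + δ) := by gcongr
    _ ≤ _ := by gcongr

/-- The standardised treatments are the summands and the scaled error sums the weights: `lln` makes
the squared weights sum to nearly 1, and `lyapunov` makes the largest negligible. -/
theorem tendsto_integral_exp_score (hD : TreatmentConditions P M μd σd)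
    (hS : ErrorConditions P M) (t : ℝ) :
    Tendsto (fun m => ∫ ω, Complex.exp (t * ((M m).score (P m) (μd m) (σd m) ω : ℝ) * Complex.I)
      ∂(P m)) atTop (𝓝 (Real.exp (-(t ^ 2 / 2)) : ℂ)) := by
  obtain ⟨C, hC0, hC⟩ := hD.exists_integral_pow_four_le
  obtain ⟨s, hs, hσ⟩ := hD.exists_le_sd
  have hσ0 : ∀ m, 0 < σd m := fun m => hs.trans_le (hσ m)
  have hT := hD.hasTreatmentMoments
  have hA : ∀ m j, Measurable fun ω => (M m).errSum j ω / (√(M m).n * (M m).S (P m)) := fun m j =>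
    ((M m).measurable_errSum j).div_const _
  have h3 := fun m j => integral_abs_pow_three_le ((hT m).memLp_sub j)
  have habs : ∀ m j ω, |((M m).d j ω - μd m) / σd m| ^ 3
      = |(M m).d j ω - μd m| ^ 3 / σd m ^ 3 := fun m j ω => by
    rw [abs_div, abs_of_pos (hσ0 m), div_pow]
  have hlln : IsLittleOp P (fun m ω =>
      ∑ j, ((M m).errSum j ω / (√(M m).n * (M m).S (P m))) ^ 2 - 1) fun _ => 1 := by
    have e : ∀ m ω, ∑ j, ((M m).errSum j ω / (√(M m).n * (M m).S (P m))) ^ 2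
        = ((M m).Ssq (P m))⁻¹ * ((M m).n : ℝ)⁻¹ * ∑ j, (M m).errSum j ω ^ 2 := fun m ω => by
      rw [Finset.mul_sum]
      refine Finset.sum_congr rfl fun j _ => ?_
      rw [div_pow, mul_pow, GroupSample.S, Real.sq_sqrt (M m).Ssq_nonneg,
        Real.sq_sqrt (Nat.cast_nonneg _), div_eq_inv_mul, mul_inv, mul_comm ((M m).n : ℝ)⁻¹]
    simp only [e]
    exact hS.lln
  have key := tendsto_integral_exp_sum_mul (P := P)
    (Z := fun m j ω => ((M m).d j ω - μd m) / σd m)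
    (A := fun m j ω => (M m).errSum j ω / (√(M m).n * (M m).S (P m)))
    (fun m j => (((M m).measurable_d j).sub_const _).div_const _) hA
    (fun m => (hD.indep m).comp (fun _ x => (x - μd m) / σd m) fun _ => by fun_prop)
    (fun m => (hD.indep_errors m).comp
      (φ := fun (z : Fin (M m).groups → ℝ) j => (z j - μd m) / σd m)
      (ψ := fun (e : (M m).Obs → ℝ) j => (∑ i, e ⟨j, i⟩) / (√(M m).n * (M m).S (P m)))
      (by fun_prop) (by fun_prop))
    (fun m j => by
      simp only [habs]
      exact (h3 m j).1.div_const _)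
    (fun m j => by
      simp only [div_pow]
      exact ((hT m).memLp_two_sub j).integrable_sq.div_const _)
    (fun m j => (((hT m).memLp_sub j).integrable (by norm_num)).div_const _)
    (fun m j => by rw [integral_div, (hT m).integral_sub, zero_div])
    (fun m j => by
      simp only [div_pow]
      rw [integral_div, (hT m).integral_sub_sq, div_self (pow_pos (hσ0 m) 2).ne'])
    -- From `|x|³ ≤ 1 + x⁴` and `σd m ≥ s`.
    (C := (1 + C) / s ^ 3) (by positivity)
    (fun m j => by
      simp only [habs]
      rw [integral_div]
      have h4 := (h3 m j).2
      have := hC m j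
      have := hσ m
      gcongr
      linarith)
    hlln
    (fun η hη => tendsto_measure_exists_lt_abs_errSum hS hη) t
  refine key.congr fun m => integral_congr_ae (Eventually.of_forall fun ω => ?_)
  simp only [GroupSample.score]
  congr 4
  rw [Finset.mul_sum, Finset.sum_div]
  refine Finset.sum_congr rfl fun j _ => ?_
  rw [div_mul_div_comm, ← div_div, inv_mul_eq_div, div_div, div_div]
  congr 1
  ring

end Asymptotics

theorem theorem3 {k : ℕ} {Ω : ℕ → Type*} [∀ m, MeasurableSpace (Ω m)]
    (P : ∀ m, Measure (Ω m)) [∀ m, IsProbabilityMeasure (P m)]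
    (M : ∀ m, GroupSample (Ω m) k) (μd σd : ℕ → ℝ)
    (hE : ErrorMoments P M) (hW : ControlConditions P M)
    (hD : TreatmentConditions P M μd σd) (hS : ErrorConditions P M) :
    -- with probability tending to one the OLS estimator is well defined
    Tendsto (fun m => P m {ω | ¬ IsUnit (((M m).X ω).transpose * (M m).X ω).det}) atTop (𝓝 0) ∧
    -- asymptotic linear expansion
    IsLittleOp P (fun m ω => (M m).stdError (P m) (σd m) ω - (M m).score (P m) (μd m) (σd m) ω)
      (fun _ => 1) ∧
    -- asymptotic normality
    TendstoInDistribution (fun m => (M m).stdError (P m) (σd m)) atTop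
      (id : ℝ → ℝ) P (gaussianReal 0 1) ∧
    -- the scale only involves within-group dependence of the errors
    (∀ m, (M m).Ssq (P m) = ((M m).n : ℝ)⁻¹ * ∑ j, Var[(M m).errSum j; P m]) := by
  obtain ⟨h1, h2⟩ := leastSquares_expansion hE hW hD hS
  exact ⟨h1, h2, tendstoInDistribution_gaussianReal_of_sub
    (fun m => (M m).measurable_stdError (P m) (σd m))
    (fun m => (M m).measurable_score (P m) (μd m) (σd m)) h2
    (tendsto_integral_exp_score hD hS), Ssq_eq_sum_variance hE⟩
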